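/- Let $\mathcal A$ be a separable $C^*$-algebra with multiplier algebra $M(\mathcal A)$, and let $\mathcal A_1,\dots,\mathcal A_n\subset\mathcal A$ be $C^*$-subalgebras such that every element of $\mathcal A_i$ commutes with every element of $\mathcal A_j$ for $i\neq j$. Write $M(\mathcal A_i)$ for the set of $m\in M(\mathcal A)$ with $m\mathcal A_i+\mathcal A_i m\subset\mathcal A_i$. Positive functionals $\varphi$ on $\mathcal A$ are extended canonically (strictly continuously) to $M(\mathcal A)$. Let $(T,\mu)$ be a measure space. A field $(c_t)_{t\in T}$ in $M(\mathcal A)$ is weak* measurable if $t\mapsto\varphi(c_t)$ is $\mu$-measurable for all $\varphi\in\mathcal A^*$; it is integrable with integral $c=\int_T c_t\,d\mu(t)\in M(\mathcal A)$ if moreover every $t\mapsto\varphi(c_t)$ is integrable and $\varphi(c)=\int_T\varphi(c_t)\,d\mu(t)$ for all $\varphi\in\mathcal A^*$ (it suffices to take positive $\varphi$). Let $I_1,\dots,I_n\subset\mathbb R$ be intervals with $0\in I_i$ for every $i$, and let $f$ be a convex, continuous real function on $I_1\times\cdots\times I_n$. For each $i$ let $(x_{it})_{t\in T}$ be a bounded,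 weak* measurable field of self-adjoint elements of $\mathcal A_i$ with spectra in $I_i$, and let $(a_{it})_{t\in T}$ be a weak* measurable field in $M(\mathcal A_i)$ such that $(a_{it}^*a_{it})_{t\in T}$ is integrable. Assume that $\sum_{i=1}^n\int_T a_{it}^*a_{it}\,d\mu(t)=\mathbf 1$. Then: (a) The integrals $y_i=\int_T a_{it}^*x_{it}a_{it}\,d\mu(t)\in M(\mathcal A)$ exist, are self-adjoint and commute with one another. (b) For each $i$, the spectrum of $y_i$ is contained in $I_i$ if $y_i\in\mathcal A$, or if the spectra of all the $x_{it}$, $t\in T$, are contained in one compact subset of $I_i$ (which is always the case when $I_i$ is closed). In the latter case the field $\bigl(a_{it}^*f(0,\dots,x_{it},\dots,0)a_{it}\bigr)_{t\in T}$ (with $x_{it}$ in the $i$-th place) is integrable. (c) If the spectrum of $y_i$ is contained in $I_i$ and the field $\bigl(a_{it}^*f(0,\dots,x_{it},\dots,0)a_{it}\bigr)_{t\in T}$ is integrable for every $i$, so that both sides of the following inequality are defined, then $$ \varphi\left(f\left(\int_T a_{1t}^*x_{1t}a_{1t}\,d\mu(t),\dots,\int_T a_{nt}^*x_{nt}a_{nt}\,d\mu(t)\right)\right)\le\varphi\left(\sum_{i=1}^n\int_T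 a_{it}^*f(0,\dots,x_{it},\dots,0)a_{it}\,d\mu(t)\right) $$ for every positive functional $\varphi$ on $\mathcal A$ which has the elements $y_i$ in its centralizer, i.e. $\varphi(xy_i)=\varphi(y_ix)$ for all $x\in\mathcal A$ and all $i$. Here $f(\cdot)$ of an abelian $n$-tuple of self-adjoint elements is formed by the joint continuous functional calculus. -/

import Mathlib

open MeasureTheory
open scoped ComplexOrder MultiplierAlgebra

namespace JensenTrace

section FunctionalCalculus

variable {B : Type*} [Ring B] [StarRing B] [Algebra ℝ B] [TopologicalSpace B] {n : ℕ}

/-- The product of the spectra of the members of an `n`-tuple. -/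
def jointBox (y : Fin n → B) : Set (Fin n → ℝ) :=
  Set.pi Set.univ fun i => spectrum ℝ (y i)

/-- The `i`-th coordinate function on the product of the spectra. -/
def coordinate (y : Fin n → B) (i : Fin n) : C(jointBox y, ℝ) :=
  ⟨fun s => s.1 i, (continuous_apply i).comp continuous_subtype_val⟩

/-- `Ψ` is the spectral calculus `g ↦ g(y)` of the tuple `y`: the (unique) continuous unital
`*`-homomorphism on the continuous functions on the product of the spectra which takes the
`i`-th coordinate function to `y i`. It exists exactly for abelian tuples
of self-adjoint elements of a C⋆-algebra. -/
def IsSpectralCalculus (y : Fin n → B) (Ψ : C(jointBox y, ℝ) →⋆ₐ[ℝ] B) : Prop :=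
  Continuous Ψ ∧ ∀ i, Ψ (coordinate y i) = y i

open Classical in
/-- The element `f(y) = f(y₁, …, yₙ)` for an abelian `n`-tuple `y` of self-adjoint elements and a
function `f` of `n` real variables which is continuous on the product of the spectra of the `yᵢ`
(and `0` if this makes no sense). -/
noncomputable def jointCfc (f : (Fin n → ℝ) → ℝ) (y : Fin n → B) : B :=
  if h : (∃ Ψ, IsSpectralCalculus y Ψ) ∧ ContinuousOn f (jointBox y) then
    h.1.choose ⟨(jointBox y).domRestrict f, h.2.domRestrict⟩
  else 0

end FunctionalCalculus

section Fields

variable {A : Type*} [NonUnitalCStarAlgebra A] [PartialOrder A] [StarOrderedRing A]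

/-- The canonical (strictly continuous, positive) extension to the multiplier algebra of a positive
functional `φ` on a C⋆-algebra: `φ(m) = lim φ(m e)`, with `e` running through the canonical
approximate unit. -/
noncomputable def multExt (φ : A →ₚ[ℂ] ℂ) (m : 𝓜(ℂ, A)) : ℂ :=
  Filter.limUnder (CStarAlgebra.approximateUnit A) fun e => φ (m.fst e)

/-- The multipliers of the C⋆-subalgebra `S` inside the multiplier algebra of `A`. -/
def multipliersOf (S : NonUnitalStarSubalgebra ℂ A) : Set 𝓜(ℂ, A) :=
  {m | ∀ c ∈ S, m.fst c ∈ S ∧ m.snd c ∈ S}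

/-- The centralizer of `φ`: those `y` with `φ(x y) = φ(y x)` for all `x` in `A`, where `y` may
be a multiplier of `A` (recall that `m.fst x = m x` and `m.snd x = x m`). -/
def centralizerOf (φ : A →ₚ[ℂ] ℂ) : Set 𝓜(ℂ, A) :=
  {y | ∀ x : A, φ (y.snd x) = φ (y.fst x)}

variable {T : Type*} [MeasurableSpace T]

/-- Weak* measurability of a field of multipliers. As the dual of a C⋆-algebra is
spanned by the positive functionals, it is enough to test on these. -/
def WeakStarMeasurable (μ : Measure T) (a : T → 𝓜(ℂ, A)) : Prop :=
  ∀ φ : A →ₚ[ℂ] ℂ, AEStronglyMeasurable (fun t => multExt φ (a t)) μ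

/-- The weak* measurable field `a` is integrable, with integral `b` in the multiplier algebra:
`φ(b) = ∫ φ(a t) dμ(t)` for all `φ` (in the dual, equivalently positive). -/
def HasFieldIntegral (μ : Measure T) (a : T → 𝓜(ℂ, A)) (b : 𝓜(ℂ, A)) : Prop :=
  WeakStarMeasurable μ a ∧ ∀ φ : A →ₚ[ℂ] ℂ,
    Integrable (fun t => multExt φ (a t)) μ ∧ multExt φ b = ∫ t, multExt φ (a t) ∂μ

/-- The field `a` is integrable. -/
def FieldIntegrable (μ : Measure T) (a : T → 𝓜(ℂ, A)) : Prop :=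
  ∃ b, HasFieldIntegral μ a b

open Classical in
/-- The integral of an integrable field, an element of the multiplier algebra
(and `0` if the field is not integrable). -/
noncomputable def fieldIntegral (μ : Measure T) (a : T → 𝓜(ℂ, A)) : 𝓜(ℂ, A) :=
  if h : FieldIntegrable μ a then h.choose else 0

end Fields

end JensenTrace

/-!
The inequality is tested on affine functions. Let `h(s) = α + ∑ gᵢ sᵢ` be an affine minorant of
`f`. Then `f(0, …, xᵢ, …, 0) ≥ α + gᵢ xᵢ`, and compressing by `aᵢ`, integrating and summing over
`i` gives `R := ∑ ∫ aᵢ* f(0, …, xᵢ, …, 0) aᵢ ≥ α + ∑ gᵢ yᵢ = h(y)`, because `∑ ∫ aᵢ* aᵢ = 1`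
(`affine_le_sum_integral`). Thus `R` dominates `h(y)` for all affine minorants of `f` at once, and
near each point of the product of the spectra of the `yᵢ` some minorant is close to `f`
(`exists_affine_minorant`). If `R` commuted with the `yᵢ`, the minorants could be glued by a
partition of unity in the variables `y`; a functional `φ` with `y` in its centralizer does not see
the difference, since `φ(R) = ∑ φ(ρ(y)^½ R ρ(y)^½)` for the members `ρ` of the partition
(`apply_le_of_local_minorants`).

The analytic part is the existence of `∫ a* x a` as a multiplier, since the integrals are only
defined weakly. The extension of a positive functional to the multiplier algebra is continuous for
the strict topology on bounded sets (`tendsto_multExt_of_strict`), and such functionals determine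
the order of the multiplier algebra (`multiplier_nonneg`). For `c` in `A` the field `a* x a c`
takes its values in the separable algebra `A`, where weak measurability is strong measurability
(`aestronglyMeasurable_of_forall`). A Cauchy–Schwarz estimate against `∫ c* a* a c`, which
converges monotonically and therefore in norm (`tendsto_of_monotone_of_forall_positive`), shows
that its weak integral is an element of `A` (`exists_integral_vector`); these elements make up a
multiplier (`exists_hasFieldIntegral_conj`).

Uniform spectral bounds of `x` carry over to `y = ∫ a* x a` by order
(`conj_integral_le_algebraMap`). For `y` in `A` a strict pointwise bound is enough, because a
positive point of the spectrum of `y` is attained by a positive functional on `A`, which commutes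
with the integral (`notMem_spectrum_of_coe`).
-/

namespace JensenTrace

open Filter Topology

/-! ### Positive functionals determine order, equality and monotone norm limits -/

section Separation

variable {A : Type*} [NonUnitalCStarAlgebra A] [PartialOrder A] [StarOrderedRing A]

/-- A real functional which is nonnegative on the positive cone agrees, on the self-adjoint part,
with a complex-linear positive functional, so real Hahn–Banach separation can be used throughout. -/
theorem exists_positive_eq_on_selfAdjoint (ψ : A →L[ℝ] ℝ) (hψ : ∀ a, 0 ≤ a → 0 ≤ ψ a) :
    ∃ φ : A →ₚ[ℂ] ℂ, ∀ a, IsSelfAdjoint a → φ a = ψ a := by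
  let ψ' : A →ₗ[ℝ] ℝ :=
    { toFun := fun a => (ψ a + ψ (star a)) / 2
      map_add' := fun a b => by simp only [star_add, map_add]; ring
      map_smul' := fun r a => by simp [star_smul]; ring }
  let χ : A →ₗ[ℂ] ℂ := Module.Dual.extendRCLike (𝕜 := ℂ) ψ'
  have hχ : ∀ a, IsSelfAdjoint a → χ a = ψ a := by
    intro a ha
    have h1 : ψ' a = ψ a := by
      change (ψ a + ψ (star a)) / 2 = ψ a
      rw [ha.star_eq]; ring
    have h2 : ψ' (Complex.I • a) = 0 := by
      change (ψ (Complex.I • a) + ψ (star (Complex.I • a))) / 2 = 0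
      rw [star_smul, ha.star_eq]
      simp
    have h3 : χ a = (ψ' a : ℂ) - Complex.I * (ψ' (Complex.I • a) : ℂ) :=
      Module.Dual.extendRCLike_apply (𝕜 := ℂ) ψ' a
    rw [h3, h1, h2]
    simp
  refine ⟨PositiveLinearMap.mk₀ χ fun a ha => ?_, hχ⟩
  rw [hχ a (.of_nonneg ha)]
  exact_mod_cast hψ a ha

/-- The positive cone is closed and convex, hence determined by the positive functionals. -/
theorem nonneg_of_forall_positive {h : A} (hsa : IsSelfAdjoint h)
    (H : ∀ φ : A →ₚ[ℂ] ℂ, 0 ≤ φ h) : 0 ≤ h := by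
  by_contra hn
  have hconv : Convex ℝ {a : A | 0 ≤ a} := by
    intro a ha b hb s t hs ht _
    exact add_nonneg (smul_nonneg hs ha) (smul_nonneg ht hb)
  obtain ⟨ψ, u, hu, hψ⟩ := geometric_hahn_banach_point_closed hconv
    CStarAlgebra.isClosed_nonneg hn
  have hu0 : u < 0 := by simpa using hψ 0 le_rfl
  have hpos : ∀ a, 0 ≤ a → 0 ≤ ψ a := by
    intro a ha
    by_contra! hlt
    have := hψ ((u / ψ a) • a) (smul_nonneg (div_nonneg_of_nonpos hu0.le hlt.le) ha)
    rw [map_smul, smul_eq_mul, div_mul_cancel₀ _ hlt.ne] at this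
    exact lt_irrefl _ this
  obtain ⟨φ, hφ⟩ := exists_positive_eq_on_selfAdjoint ψ hpos
  have := H φ
  rw [hφ h hsa] at this
  have h2 : 0 ≤ ψ h := by exact_mod_cast this
  linarith

theorem eq_zero_of_forall_positive {a : A} (H : ∀ φ : A →ₚ[ℂ] ℂ, φ a = 0) : a = 0 := by
  have key : ∀ h : A, IsSelfAdjoint h → (∀ φ : A →ₚ[ℂ] ℂ, φ h = 0) → h = 0 := by
    intro h hsa hz
    refine le_antisymm ?_ (nonneg_of_forall_positive hsa fun φ => (hz φ).ge)
    exact neg_nonneg.1 (nonneg_of_forall_positive hsa.neg fun φ => by simp [hz φ])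
  have hre : (realPart a : A) = 0 := key _ (realPart a).2 fun φ => by
    rw [realPart_apply_coe, PositiveLinearMap.map_smul_of_tower, map_add, map_star, H]; simp
  have him : (imaginaryPart a : A) = 0 := key _ (imaginaryPart a).2 fun φ => by
    rw [imaginaryPart_apply_coe, map_smul, PositiveLinearMap.map_smul_of_tower, map_sub, map_star,
      H]; simp
  rw [← realPart_add_I_smul_imaginaryPart a, hre, him]; simp

theorem le_of_forall_positive {a b : A} (ha : IsSelfAdjoint a) (hb : IsSelfAdjoint b)
    (H : ∀ φ : A →ₚ[ℂ] ℂ, φ a ≤ φ b) : a ≤ b :=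
  sub_nonneg.1 <| nonneg_of_forall_positive (hb.sub ha) fun φ => by
    rw [map_sub]; exact sub_nonneg.2 (H φ)

theorem eq_of_forall_positive {a b : A} (H : ∀ φ : A →ₚ[ℂ] ℂ, φ a = φ b) : a = b :=
  sub_eq_zero.1 <| eq_zero_of_forall_positive fun φ => by rw [map_sub, H, sub_self]

/-- A monotone sequence which converges weakly to an element of the algebra converges in norm
(Dini's theorem): `L` is in the weak, hence the norm closure of the convex, downward closed set of
elements below some `S k`. -/
theorem tendsto_of_monotone_of_forall_positive {S : ℕ → A} (hS : Monotone S)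
    (hSsa : ∀ k, IsSelfAdjoint (S k)) {L : A} (hL : IsSelfAdjoint L)
    (H : ∀ φ : A →ₚ[ℂ] ℂ, Tendsto (fun k => φ (S k)) atTop (𝓝 (φ L))) :
    Tendsto S atTop (𝓝 L) := by
  have hle : ∀ k, S k ≤ L := fun k => le_of_forall_positive (hSsa k) hL fun φ =>
    ge_of_tendsto (H φ) <| (eventually_ge_atTop k).mono fun l hl =>
      OrderHomClass.mono φ (hS hl)
  let K : Set A := {d | ∃ k, d ≤ S k}
  have hK : Convex ℝ K := by
    rintro a ⟨k, hk⟩ b ⟨l, hl⟩ s t hs ht hst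
    refine ⟨max k l, ?_⟩
    calc s • a + t • b ≤ s • S (max k l) + t • S (max k l) :=
          add_le_add (smul_le_smul_of_nonneg_left (hk.trans (hS (le_max_left _ _))) hs)
            (smul_le_smul_of_nonneg_left (hl.trans (hS (le_max_right _ _))) ht)
      _ = S (max k l) := by rw [← add_smul, hst, one_smul]
  -- a functional which is bounded above on the downward closed set `K` is positive
  have hmem : L ∈ closure K := by
    by_contra hn
    obtain ⟨ψ, u, hψ, hu⟩ := geometric_hahn_banach_closed_point hK.closure isClosed_closure hn
    have hpos : ∀ a, 0 ≤ a → 0 ≤ ψ a := by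
      intro a ha
      by_contra! hlt
      set r : ℝ := max 0 ((u - ψ (S 0)) / (-ψ a)) with hr
      have h1 := hψ (S 0 - r • a) (subset_closure
        ⟨0, sub_le_self _ (smul_nonneg (le_max_left _ _) ha)⟩)
      rw [map_sub, map_smul, smul_eq_mul] at h1
      have h2 : (u - ψ (S 0)) / (-ψ a) ≤ r := le_max_right _ _
      rw [div_le_iff₀ (by linarith)] at h2
      linarith
    obtain ⟨φ, hφ⟩ := exists_positive_eq_on_selfAdjoint ψ hpos
    have h3 := H φ
    rw [hφ L hL] at h3
    simp only [hφ _ (hSsa _)] at h3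
    have h4 : Tendsto (fun k => ψ (S k)) atTop (𝓝 (ψ L)) := by
      simpa [Function.comp_def] using (Complex.continuous_re.tendsto _).comp h3
    have h5 : ψ L ≤ u := le_of_tendsto' h4 fun k => (hψ _ (subset_closure ⟨k, le_rfl⟩)).le
    linarith
  rw [Metric.tendsto_atTop]
  intro ε hε
  obtain ⟨d, ⟨k, hk⟩, hd⟩ := Metric.mem_closure_iff.1 hmem ε hε
  refine ⟨k, fun l hl => ?_⟩
  rw [dist_eq_norm] at hd
  rw [dist_comm, dist_eq_norm]
  refine lt_of_le_of_lt (CStarAlgebra.norm_le_norm_of_nonneg_of_le (sub_nonneg.2 (hle l)) ?_) hd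
  exact sub_le_sub_left (hk.trans (hS hl)) L

/-- The Cauchy–Schwarz inequality, read off from the GNS inner product. -/
theorem norm_apply_star_mul_sq_le (φ : A →ₚ[ℂ] ℂ) (a b : A) :
    ‖φ (star a * b)‖ ^ 2 ≤ ‖φ (star a * a)‖ * ‖φ (star b * b)‖ := by
  have h := norm_inner_le_norm (𝕜 := ℂ) (φ.toPreGNS a) (φ.toPreGNS b)
  rw [PositiveLinearMap.preGNS_inner_def] at h
  have ha := congrArg norm (φ.preGNS_norm_sq (φ.toPreGNS a))
  have hb := congrArg norm (φ.preGNS_norm_sq (φ.toPreGNS b))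
  simp only [PositiveLinearMap.ofPreGNS_toPreGNS, norm_pow, Complex.norm_real, norm_norm]
    at h ha hb
  rw [← ha, ← hb, ← mul_pow]
  gcongr

end Separation

/-! ### The extension of positive functionals to the multiplier algebra -/

section Extension

variable {A : Type*} [NonUnitalCStarAlgebra A]

/-- The multiplier algebra carries the order given by its C⋆-structure; `A` itself comes with an
order by assumption. -/
noncomputable instance : PartialOrder 𝓜(ℂ, A) := CStarAlgebra.spectralOrder _

instance : StarOrderedRing 𝓜(ℂ, A) := CStarAlgebra.spectralOrderedRing _

theorem eq_of_forall_mul_left_eq {u v : A} (h : ∀ x : A, x * u = x * v) : u = v := by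
  have h1 : star (u - v) * (u - v) = 0 := by rw [mul_sub, h, sub_self]
  exact sub_eq_zero.1 ((CStarRing.star_mul_self_eq_zero_iff _).1 h1)

theorem eq_of_forall_mul_right_eq {u v : A} (h : ∀ x : A, u * x = v * x) : u = v := by
  have h1 : (u - v) * star (u - v) = 0 := by rw [sub_mul, h, sub_self]
  exact sub_eq_zero.1 ((CStarRing.mul_star_self_eq_zero_iff _).1 h1)

theorem fst_mul (m : 𝓜(ℂ, A)) (c d : A) : m.fst (c * d) = m.fst c * d :=
  eq_of_forall_mul_left_eq fun x => by
    rw [← m.central, ← mul_assoc, m.central, mul_assoc]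

/-- A multiplier is determined by its left action. -/
theorem multiplier_ext {m m' : 𝓜(ℂ, A)} (h : ∀ c, m.fst c = m'.fst c) : m = m' := by
  have h1 : m.fst = m'.fst := ContinuousLinearMap.ext h
  refine DoubleCentralizer.ext _ _ _ _ (Prod.ext h1 (ContinuousLinearMap.ext fun c => ?_))
  exact eq_of_forall_mul_right_eq fun x => by rw [m.central, m'.central, h]

@[simp]
theorem coe_mul' (c d : A) : ((c * d : A) : 𝓜(ℂ, A)) = (c : 𝓜(ℂ, A)) * d :=
  map_mul (DoubleCentralizer.coeHom (𝕜 := ℂ) (A := A)) c d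

@[simp]
theorem coe_star' (c : A) : ((star c : A) : 𝓜(ℂ, A)) = star (c : 𝓜(ℂ, A)) :=
  map_star (DoubleCentralizer.coeHom (𝕜 := ℂ) (A := A)) c

@[simp]
theorem coe_add' (c d : A) : ((c + d : A) : 𝓜(ℂ, A)) = (c : 𝓜(ℂ, A)) + d :=
  map_add (DoubleCentralizer.coeHom (𝕜 := ℂ) (A := A)) c d

@[simp]
theorem coe_sub' (c d : A) : ((c - d : A) : 𝓜(ℂ, A)) = (c : 𝓜(ℂ, A)) - d :=
  map_sub (DoubleCentralizer.coeHom (𝕜 := ℂ) (A := A)) c d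

@[simp]
theorem coe_zero' : ((0 : A) : 𝓜(ℂ, A)) = 0 :=
  map_zero (DoubleCentralizer.coeHom (𝕜 := ℂ) (A := A))

@[simp]
theorem coe_smul' (r : ℂ) (c : A) : ((r • c : A) : 𝓜(ℂ, A)) = r • (c : 𝓜(ℂ, A)) :=
  map_smul (DoubleCentralizer.coeHom (𝕜 := ℂ) (A := A)) r c

theorem coe_injective' : Function.Injective (fun c : A => (c : 𝓜(ℂ, A))) := fun c d h =>
  eq_of_forall_mul_right_eq fun x => by
    have := congrArg (fun m : 𝓜(ℂ, A) => m.fst x) h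
    simpa using this

theorem norm_coe' (c : A) : ‖(c : 𝓜(ℂ, A))‖ = ‖c‖ :=
  NonUnitalStarAlgHom.norm_map (DoubleCentralizer.coeHom (𝕜 := ℂ) (A := A)) coe_injective' c

theorem mul_coe (m : 𝓜(ℂ, A)) (c : A) : m * (c : 𝓜(ℂ, A)) = (m.fst c : A) :=
  multiplier_ext fun d => by simp [fst_mul]

theorem coe_mul_multiplier (m : 𝓜(ℂ, A)) (c : A) : (c : 𝓜(ℂ, A)) * m = (m.snd c : A) :=
  multiplier_ext fun d => by simp [m.central]

theorem norm_fst_apply_le (m : 𝓜(ℂ, A)) (c : A) : ‖m.fst c‖ ≤ ‖m‖ * ‖c‖ := by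
  simpa using m.fst.le_opNorm c

theorem isSelfAdjoint_coe {c : A} (hc : IsSelfAdjoint c) :
    IsSelfAdjoint (c : 𝓜(ℂ, A)) := by
  rw [IsSelfAdjoint, ← coe_star', hc.star_eq]

/-- Polarization, with a weight `m`. -/
theorem polarization (c d m : 𝓜(ℂ, A)) :
    star d * m * c = (4 : ℂ)⁻¹ • (star (c + d) * m * (c + d)
      - star (c - d) * m * (c - d)
      + Complex.I • (star (c + Complex.I • d) * m * (c + Complex.I • d))
      - Complex.I • (star (c - Complex.I • d) * m * (c - Complex.I • d))) := by
  simp only [star_add, star_sub, star_smul, add_mul, mul_add, sub_mul, mul_sub, smul_mul_assoc,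
    mul_smul_comm, smul_add, smul_sub, smul_smul, RCLike.star_def, Complex.conj_I]
  simp only [mul_neg, Complex.I_mul_I, neg_smul, neg_neg]
  module

variable [PartialOrder A] [StarOrderedRing A]

theorem coe_nonneg {c : A} (hc : 0 ≤ c) : 0 ≤ (c : 𝓜(ℂ, A)) := by
  obtain ⟨b, rfl⟩ := CStarAlgebra.nonneg_iff_eq_star_mul_self.1 hc
  rw [coe_mul', coe_star']
  exact star_mul_self_nonneg _

/-- Beyond a suitable `e₀`, the increments of `φ` along the unit ball are small, since `φ` is
bounded and monotone on the positive part of the ball. -/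
theorem exists_small_increment (φ : A →ₚ[ℂ] ℂ) {δ : ℝ} (hδ : 0 < δ) :
    ∃ e₀ : A, (0 ≤ e₀ ∧ ‖e₀‖ < 1) ∧ ∀ e, e₀ ≤ e → ‖e‖ ≤ 1 → ‖φ (e - e₀)‖ ≤ δ := by
  obtain ⟨C, hC⟩ := PositiveLinearMap.exists_norm_apply_le φ
  let s : Set ℝ := {r | ∃ e : A, 0 ≤ e ∧ ‖e‖ < 1 ∧ r = ‖φ e‖}
  have hs : BddAbove s := by
    refine ⟨C, ?_⟩
    rintro r ⟨e, -, he, rfl⟩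
    refine (hC e).trans ?_
    exact mul_le_of_le_one_right C.2 he.le
  have hne : s.Nonempty := ⟨_, 0, le_rfl, by simp, rfl⟩
  obtain ⟨r, ⟨e₀, he₀, hn₀, rfl⟩, hr⟩ := exists_lt_of_lt_csSup hne (sub_lt_self (sSup s) hδ)
  have norm_eq : ∀ a : A, 0 ≤ a → ‖φ a‖ = (φ a).re := fun a ha =>
    Complex.norm_of_nonneg' (φ.map_nonneg ha) ▸ by simp
  refine ⟨e₀, ⟨he₀, hn₀⟩, fun e hle hn => ?_⟩
  have he : 0 ≤ e := he₀.trans hle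
  have h1 : ‖φ e‖ ≤ sSup s := by
    -- `s` only has the elements of norm `< 1`, whereas `‖e‖ = 1` is allowed
    have ht : Tendsto (fun r : ℝ => r * ‖φ e‖) (𝓝[<] 1) (𝓝 ‖φ e‖) := by
      have : Tendsto (fun r : ℝ => r * ‖φ e‖) (𝓝 1) (𝓝 (1 * ‖φ e‖)) :=
        (continuous_id.mul continuous_const).tendsto 1
      rw [one_mul] at this
      exact this.mono_left nhdsWithin_le_nhds
    refine le_of_tendsto ht ?_
    filter_upwards [Ioo_mem_nhdsLT (zero_lt_one' ℝ)] with r hr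
    refine le_csSup hs ⟨r • e, smul_nonneg hr.1.le he, ?_, ?_⟩
    · rw [norm_smul, Real.norm_of_nonneg hr.1.le]
      nlinarith [hr.1, hr.2, norm_nonneg e]
    · rw [PositiveLinearMap.map_smul_of_tower, norm_smul, Real.norm_of_nonneg hr.1.le]
  rw [norm_eq _ (sub_nonneg.2 hle), map_sub, Complex.sub_re, ← norm_eq _ he, ← norm_eq _ he₀]
  linarith

/-- The net `φ(m e)` is Cauchy, uniformly for `m` in the unit ball: by Cauchy–Schwarz applied to
`m p = (m √p) √p` the increment `φ(m p)`, `p = e - e₀`, is controlled by `φ(p)`. -/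
theorem eventually_uniform_approx (φ : A →ₚ[ℂ] ℂ) {ε : ℝ} (hε : 0 < ε) :
    ∃ e₀ : A, (0 ≤ e₀ ∧ ‖e₀‖ < 1) ∧ ∀ e, e₀ ≤ e → ‖e‖ ≤ 1 → ∀ m : 𝓜(ℂ, A),
      ‖φ (m.fst e) - φ (m.fst e₀)‖ ≤ ε * ‖m‖ := by
  obtain ⟨C, hC⟩ := PositiveLinearMap.exists_norm_apply_le φ
  obtain ⟨e₀, he₀, h⟩ := exists_small_increment φ (δ := ε ^ 2 / (2 * C + 1)) (by positivity)
  refine ⟨e₀, he₀, fun e hle hn m => ?_⟩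
  have hp : 0 ≤ e - e₀ := sub_nonneg.2 hle
  set p := e - e₀ with hpdef
  have hs : CFC.sqrt p * CFC.sqrt p = p := CFC.sqrt_mul_sqrt_self p hp
  set s := CFC.sqrt p
  have hsa : star s = s := (IsSelfAdjoint.of_nonneg (CFC.sqrt_nonneg p)).star_eq
  rw [← map_sub, ← map_sub, ← hpdef]
  have h1 := norm_apply_star_mul_sq_le φ (star (m.fst s)) s
  rw [star_star, ← fst_mul, hsa, hs] at h1
  have hp2 : ‖p‖ ≤ 2 := (norm_sub_le _ _).trans (by linarith [he₀.2])
  have hss : ‖s‖ * ‖s‖ = ‖p‖ := by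
    rw [← CStarRing.norm_star_mul_self, hsa, hs]
  have h2 : ‖φ (m.fst s * star (m.fst s))‖ ≤ C * (2 * ‖m‖ ^ 2) := by
    refine (hC _).trans (mul_le_mul_of_nonneg_left ?_ C.2)
    rw [CStarRing.norm_self_mul_star]
    have h3 := norm_fst_apply_le m s
    calc ‖m.fst s‖ * ‖m.fst s‖ ≤ (‖m‖ * ‖s‖) * (‖m‖ * ‖s‖) := by gcongr
      _ = ‖p‖ * ‖m‖ ^ 2 := by rw [← hss]; ring
      _ ≤ 2 * ‖m‖ ^ 2 := by gcongr
  have h4 := h e hle hn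
  have h5 : ‖φ (m.fst p)‖ ^ 2 ≤ (ε * ‖m‖) ^ 2 := by
    have hC0 : (0 : ℝ) ≤ C := C.2
    calc ‖φ (m.fst p)‖ ^ 2 ≤ C * (2 * ‖m‖ ^ 2) * (ε ^ 2 / (2 * C + 1)) :=
          h1.trans (mul_le_mul h2 h4 (norm_nonneg _) (by positivity))
      _ = (ε * ‖m‖) ^ 2 * (2 * C / (2 * C + 1)) := by ring
      _ ≤ (ε * ‖m‖) ^ 2 * 1 := by
        gcongr
        exact div_le_one_of_le₀ (by linarith) (by positivity)
      _ = _ := mul_one _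
  exact (sq_le_sq₀ (norm_nonneg _) (by positivity)).1 h5

/-- The limit which defines `multExt` exists. -/
theorem tendsto_multExt (φ : A →ₚ[ℂ] ℂ) (m : 𝓜(ℂ, A)) :
    Tendsto (fun e => φ (m.fst e)) (CStarAlgebra.approximateUnit A) (𝓝 (multExt φ m)) := by
  refine tendsto_nhds_limUnder ?_
  refine cauchy_map_iff_exists_tendsto.1 ?_
  rw [Metric.cauchy_iff]
  refine ⟨inferInstance, fun ε hε => ?_⟩
  obtain ⟨e₀, he₀, h⟩ := eventually_uniform_approx φ (ε := ε / (4 * (‖m‖ + 1))) (by positivity)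
  refine ⟨_, image_mem_map ((CStarAlgebra.hasBasis_approximateUnit A).mem_of_mem he₀), ?_⟩
  rintro _ ⟨e, he, rfl⟩ _ ⟨e', he', rfl⟩
  have h1 := h e he.1 (by simpa using he.2) m
  have h2 := h e' he'.1 (by simpa using he'.2) m
  rw [← dist_eq_norm] at h1 h2
  have h3 : ε / (4 * (‖m‖ + 1)) * ‖m‖ ≤ ε / 4 := by
    rw [div_mul_eq_mul_div, div_le_div_iff₀ (by positivity) (by norm_num)]
    nlinarith [norm_nonneg m]
  have := dist_triangle_right (φ (m.fst e)) (φ (m.fst e')) (φ (m.fst e₀))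
  linarith

/-- The extension is uniformly approximated on bounded sets by the functionals `m ↦ φ(m e)`. -/
theorem exists_multExt_approx (φ : A →ₚ[ℂ] ℂ) {ε : ℝ} (hε : 0 < ε) :
    ∃ e : A, ∀ m : 𝓜(ℂ, A), ‖multExt φ m - φ (m.fst e)‖ ≤ ε * ‖m‖ := by
  obtain ⟨e₀, he₀, h⟩ := eventually_uniform_approx φ hε
  refine ⟨e₀, fun m => le_of_tendsto (((tendsto_multExt φ m).sub_const _).norm) ?_⟩
  filter_upwards [(CStarAlgebra.hasBasis_approximateUnit A).mem_of_mem he₀] with e he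
  exact h e he.1 (by simpa using he.2) m

/-- Positive functionals are continuous for the strict topology on bounded sets. -/
theorem tendsto_multExt_of_strict (φ : A →ₚ[ℂ] ℂ) {ι : Type*} {l : Filter ι} {g : ι → 𝓜(ℂ, A)}
    {m : 𝓜(ℂ, A)} {C : ℝ} (hC : ∀ᶠ i in l, ‖g i‖ ≤ C)
    (hg : ∀ d, Tendsto (fun i => (g i).fst d) l (𝓝 (m.fst d))) :
    Tendsto (fun i => multExt φ (g i)) l (𝓝 (multExt φ m)) := by
  rw [Metric.tendsto_nhds]
  intro ε hε
  set D : ℝ := max C ‖m‖ with hD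
  have hD0 : 0 ≤ D := (norm_nonneg m).trans (le_max_right _ _)
  obtain ⟨e, he⟩ := exists_multExt_approx φ (ε := ε / (4 * (D + 1))) (by positivity)
  have key : ∀ x : 𝓜(ℂ, A), ‖x‖ ≤ D → dist (multExt φ x) (φ (x.fst e)) ≤ ε / 4 := by
    intro x hx
    rw [dist_eq_norm]
    refine (he x).trans ?_
    rw [div_mul_eq_mul_div, div_le_div_iff₀ (by positivity) (by norm_num)]
    nlinarith
  have h1 : Tendsto (fun i => φ ((g i).fst e)) l (𝓝 (φ (m.fst e))) :=
    ((map_continuous φ).tendsto _).comp (hg e)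
  filter_upwards [hC, (Metric.tendsto_nhds.1 h1) (ε / 4) (by positivity)] with i hi h2
  have h3 := key (g i) (hi.trans (le_max_left _ _))
  have h4 := key m (le_max_right _ _)
  have h5 := dist_triangle4 (multExt φ (g i)) (φ ((g i).fst e)) (φ (m.fst e)) (multExt φ m)
  rw [dist_comm (φ (m.fst e)) (multExt φ m)] at h5
  linarith

theorem multExt_coe (φ : A →ₚ[ℂ] ℂ) (c : A) : multExt φ (c : 𝓜(ℂ, A)) = φ c :=
  tendsto_nhds_unique (tendsto_multExt φ (c : 𝓜(ℂ, A)))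
    (((map_continuous φ).tendsto _).comp
      ((CStarAlgebra.increasingApproximateUnit A).tendsto_mul_left c))

theorem tendsto_mul_approximateUnit (c : A) :
    Tendsto (fun e => e * c) (CStarAlgebra.approximateUnit A) (𝓝 c) :=
  (CStarAlgebra.increasingApproximateUnit A).tendsto_mul_right c

/-- `w e v → w v` strictly, for multipliers. -/
theorem tendsto_multExt_mul_approximateUnit_mul (φ : A →ₚ[ℂ] ℂ) (w v : 𝓜(ℂ, A)) :
    Tendsto (fun e : A => multExt φ (w * (e : 𝓜(ℂ, A)) * v)) (CStarAlgebra.approximateUnit A)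
      (𝓝 (multExt φ (w * v))) := by
  refine tendsto_multExt_of_strict φ (C := ‖w‖ * 1 * ‖v‖) ?_ fun d => ?_
  · filter_upwards [(CStarAlgebra.increasingApproximateUnit A).eventually_norm] with e he
    rw [← norm_coe'] at he
    refine (norm_mul_le _ _).trans ?_
    gcongr
    refine (norm_mul_le _ _).trans ?_
    gcongr
  · simpa [Function.comp_def] using
      (w.fst.continuous.tendsto _).comp (tendsto_mul_approximateUnit (v.fst d))

/-- The extension of a positive functional, as a positive functional on the multiplier algebra. -/
noncomputable def extend (φ : A →ₚ[ℂ] ℂ) : 𝓜(ℂ, A) →ₚ[ℂ] ℂ :=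
  PositiveLinearMap.mk₀
    { toFun := multExt φ
      map_add' := fun m m' => tendsto_nhds_unique (tendsto_multExt φ (m + m')) <| by
        simpa using (tendsto_multExt φ m).add (tendsto_multExt φ m')
      map_smul' := fun r m => tendsto_nhds_unique (tendsto_multExt φ (r • m)) <| by
        simpa using (tendsto_multExt φ m).const_mul r }
    (by
      intro m hm
      obtain ⟨b, rfl⟩ := CStarAlgebra.nonneg_iff_eq_star_mul_self.1 hm
      refine ge_of_tendsto (tendsto_multExt_mul_approximateUnit_mul φ (star b) b) ?_
      filter_upwards [(CStarAlgebra.increasingApproximateUnit A).eventually_nonneg] with e he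
      obtain ⟨s, rfl⟩ := CStarAlgebra.nonneg_iff_eq_star_mul_self.1 he
      have : star b * ((star s * s : A) : 𝓜(ℂ, A)) * b = (star (b.snd s) * b.snd s : A) := by
        rw [coe_mul', coe_mul', coe_star', coe_star', ← coe_mul_multiplier, star_mul]
        simp only [mul_assoc]
      rw [this, multExt_coe]
      exact φ.map_nonneg (star_mul_self_nonneg _))

theorem extend_apply (φ : A →ₚ[ℂ] ℂ) (m : 𝓜(ℂ, A)) : extend φ m = multExt φ m := rfl

@[simp]
theorem extend_coe (φ : A →ₚ[ℂ] ℂ) (c : A) : extend φ (c : 𝓜(ℂ, A)) = φ c := multExt_coe φ c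

/-- The positive functional `φ(c* · c)` on `A`, for a multiplier `c`. -/
noncomputable def conjFunctional (φ : A →ₚ[ℂ] ℂ) (c : 𝓜(ℂ, A)) : A →ₚ[ℂ] ℂ :=
  PositiveLinearMap.mk₀
    { toFun := fun d => extend φ (star c * (d : 𝓜(ℂ, A)) * c)
      map_add' := fun d d' => by rw [coe_add', mul_add, add_mul, map_add]
      map_smul' := fun r d => by
        rw [coe_smul', mul_smul_comm, smul_mul_assoc, map_smul]; rfl }
    (fun d hd => (extend φ).map_nonneg (star_left_conjugate_nonneg (coe_nonneg hd) c))

theorem conjFunctional_apply (φ : A →ₚ[ℂ] ℂ) (c : 𝓜(ℂ, A)) (d : A) :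
    conjFunctional φ c d = extend φ (star c * (d : 𝓜(ℂ, A)) * c) := rfl

theorem extend_conjFunctional (φ : A →ₚ[ℂ] ℂ) (c m : 𝓜(ℂ, A)) :
    extend (conjFunctional φ c) m = extend φ (star c * m * c) := by
  refine tendsto_nhds_unique (tendsto_multExt (conjFunctional φ c) m) ?_
  refine (tendsto_multExt_mul_approximateUnit_mul φ (star c * m) c).congr fun e => ?_
  rw [conjFunctional_apply, ← mul_coe, extend_apply]
  simp only [mul_assoc]

/-- The extended functionals separate the multipliers: `c* m c` is in `A` for `c` in `A`. -/
theorem multiplier_eq_zero {m : 𝓜(ℂ, A)} (H : ∀ φ : A →ₚ[ℂ] ℂ, extend φ m = 0) : m = 0 := by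
  have h1 : ∀ c d : A, star (d : 𝓜(ℂ, A)) * m * c = 0 := by
    have h2 : ∀ c : A, star (c : 𝓜(ℂ, A)) * m * c = 0 := by
      intro c
      rw [mul_assoc, mul_coe, ← coe_star', ← coe_mul']
      have : star c * m.fst c = 0 := eq_zero_of_forall_positive fun φ => by
        rw [← extend_coe, coe_mul', coe_star', ← mul_coe, ← mul_assoc, ← extend_conjFunctional, H]
      rw [this, coe_zero']
    intro c d
    rw [polarization]
    simp only [← coe_add', ← coe_sub', ← coe_smul', h2]
    simp
  refine multiplier_ext fun c => ?_
  have h3 := h1 c (m.fst c)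
  rw [mul_assoc, mul_coe, ← coe_star', ← coe_mul', ← coe_zero'] at h3
  simpa using (CStarRing.star_mul_self_eq_zero_iff _).1 (coe_injective' h3)

theorem multiplier_eq_of_forall {m m' : 𝓜(ℂ, A)}
    (H : ∀ φ : A →ₚ[ℂ] ℂ, extend φ m = extend φ m') : m = m' :=
  sub_eq_zero.1 <| multiplier_eq_zero fun φ => by rw [map_sub, H, sub_self]

/-- The extended functionals determine the order of the multiplier algebra. They are not all of its
positive functionals, but together with `φ` they contain `φ(c* · c)`; with `c = m⁻` this
shows that `(m⁻)³ = 0`. -/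
theorem multiplier_nonneg {m : 𝓜(ℂ, A)} (H : ∀ φ : A →ₚ[ℂ] ℂ, 0 ≤ extend φ m) : 0 ≤ m := by
  have hsa : IsSelfAdjoint m := multiplier_eq_of_forall fun φ => by
    rw [map_star]; exact (IsSelfAdjoint.of_nonneg (H φ)).star_eq
  have hneg : 0 ≤ m⁻ * m⁻ * m⁻ := by
    have := star_left_conjugate_nonneg (CFC.negPart_nonneg m) m⁻
    rwa [(IsSelfAdjoint.of_nonneg (CFC.negPart_nonneg m)).star_eq] at this
  have hzero : m⁻ * m⁻ * m⁻ = 0 := by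
    refine multiplier_eq_zero fun φ => ?_
    refine le_antisymm ?_ ((extend φ).map_nonneg hneg)
    have h1 := H (conjFunctional φ m⁻)
    rw [extend_conjFunctional, (IsSelfAdjoint.of_nonneg (CFC.negPart_nonneg m)).star_eq] at h1
    have h2 : m⁻ * m * m⁻ = -(m⁻ * m⁻ * m⁻) := by
      calc m⁻ * m * m⁻ = m⁻ * (m⁺ - m⁻) * m⁻ := by rw [CFC.posPart_sub_negPart m hsa]
        _ = _ := by rw [mul_sub, CFC.negPart_mul_posPart]; simp
    rw [h2, map_neg] at h1
    exact neg_nonneg.1 h1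
  have h0 : m⁻ = 0 := by
    have hs := (IsSelfAdjoint.of_nonneg (CFC.negPart_nonneg m)).star_eq
    have h1 : m⁻ * m⁻ = 0 := by
      rw [← CStarRing.star_mul_self_eq_zero_iff, star_mul, hs, ← mul_assoc, hzero, zero_mul]
    rwa [← CStarRing.star_mul_self_eq_zero_iff, hs]
  exact (CFC.negPart_eq_zero_iff m hsa).1 h0

theorem multiplier_le_of_forall {m m' : 𝓜(ℂ, A)}
    (H : ∀ φ : A →ₚ[ℂ] ℂ, extend φ m ≤ extend φ m') : m ≤ m' :=
  sub_nonneg.1 <| multiplier_nonneg fun φ => by rw [map_sub]; exact sub_nonneg.2 (H φ)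

end Extension

/-! ### Algebra of weak* integrals -/

section FieldIntegral

variable {A : Type*} [NonUnitalCStarAlgebra A] [PartialOrder A] [StarOrderedRing A]
variable {T : Type*} [MeasurableSpace T] {μ : Measure T}

/-- Weak* measurability is part of the integrability of the fields `φ(a t)`. -/
theorem hasFieldIntegral_iff {a : T → 𝓜(ℂ, A)} {b : 𝓜(ℂ, A)} :
    HasFieldIntegral μ a b ↔ ∀ φ : A →ₚ[ℂ] ℂ,
      Integrable (fun t => extend φ (a t)) μ ∧ extend φ b = ∫ t, extend φ (a t) ∂μ :=
  ⟨fun h => h.2, fun h => ⟨fun φ => (h φ).1.aestronglyMeasurable, h⟩⟩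

namespace HasFieldIntegral

variable {a a' : T → 𝓜(ℂ, A)} {b b' : 𝓜(ℂ, A)}

theorem integrable (h : HasFieldIntegral μ a b) (φ : A →ₚ[ℂ] ℂ) :
    Integrable (fun t => extend φ (a t)) μ := (h.2 φ).1

theorem extend_eq (h : HasFieldIntegral μ a b) (φ : A →ₚ[ℂ] ℂ) :
    extend φ b = ∫ t, extend φ (a t) ∂μ := (h.2 φ).2

theorem unique (h : HasFieldIntegral μ a b) (h' : HasFieldIntegral μ a b') : b = b' :=
  multiplier_eq_of_forall fun φ => by rw [h.extend_eq, h'.extend_eq]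

theorem fieldIntegrable (h : HasFieldIntegral μ a b) : FieldIntegrable μ a := ⟨b, h⟩

protected theorem add (h : HasFieldIntegral μ a b) (h' : HasFieldIntegral μ a' b') :
    HasFieldIntegral μ (fun t => a t + a' t) (b + b') :=
  hasFieldIntegral_iff.2 fun φ => by
    simp only [map_add]
    exact ⟨(h.integrable φ).add (h'.integrable φ), by
      rw [integral_add (h.integrable φ) (h'.integrable φ), h.extend_eq, h'.extend_eq]⟩

protected theorem smul (r : ℂ) (h : HasFieldIntegral μ a b) :
    HasFieldIntegral μ (fun t => r • a t) (r • b) :=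
  hasFieldIntegral_iff.2 fun φ => by
    simp only [map_smul]
    exact ⟨(h.integrable φ).smul r, by rw [integral_smul, h.extend_eq]⟩

protected theorem real_smul (r : ℝ) (h : HasFieldIntegral μ a b) :
    HasFieldIntegral μ (fun t => r • a t) (r • b) := by
  simpa only [Complex.coe_smul] using h.smul (r : ℂ)

protected theorem sub (h : HasFieldIntegral μ a b) (h' : HasFieldIntegral μ a' b') :
    HasFieldIntegral μ (fun t => a t - a' t) (b - b') := by
  simpa [sub_eq_add_neg] using h.add (h'.smul (-1))

protected theorem neg (h : HasFieldIntegral μ a b) :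
    HasFieldIntegral μ (fun t => - a t) (-b) := by
  simpa using h.smul (-1)

/-- Compressions pass through the integral because `φ(c* · c)` is again a positive functional. -/
theorem conj (h : HasFieldIntegral μ a b) (c : 𝓜(ℂ, A)) :
    HasFieldIntegral μ (fun t => star c * a t * c) (star c * b * c) :=
  hasFieldIntegral_iff.2 fun φ => by
    simp only [← extend_conjFunctional]
    exact h.2 _

theorem star_mul_mul (h : HasFieldIntegral μ a b) (d c : 𝓜(ℂ, A)) :
    HasFieldIntegral μ (fun t => star d * a t * c) (star d * b * c) := by
  simp only [polarization c d]
  exact ((((h.conj _).sub (h.conj _)).add ((h.conj _).smul _)).sub ((h.conj _).smul _)).smul _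

theorem mul_mul (h : HasFieldIntegral μ a b) (d c : 𝓜(ℂ, A)) :
    HasFieldIntegral μ (fun t => d * a t * c) (d * b * c) := by
  simpa using h.star_mul_mul (star d) c

theorem mul_left (h : HasFieldIntegral μ a b) (d : 𝓜(ℂ, A)) :
    HasFieldIntegral μ (fun t => d * a t) (d * b) := by simpa using h.mul_mul d 1

theorem mul_right (h : HasFieldIntegral μ a b) (c : 𝓜(ℂ, A)) :
    HasFieldIntegral μ (fun t => a t * c) (b * c) := by simpa using h.mul_mul 1 c

protected theorem star (h : HasFieldIntegral μ a b) :
    HasFieldIntegral μ (fun t => star (a t)) (star b) :=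
  hasFieldIntegral_iff.2 fun φ => by
    simp only [map_star, h.extend_eq φ]
    exact ⟨RCLike.conjCLE.toContinuousLinearMap.integrable_comp (h.integrable φ),
      integral_conj.symm⟩

theorem isSelfAdjoint (h : HasFieldIntegral μ a b) (ha : ∀ t, IsSelfAdjoint (a t)) :
    IsSelfAdjoint b := by
  have h1 := h.star
  simp only [(ha _).star_eq] at h1
  exact h1.unique h

theorem nonneg (h : HasFieldIntegral μ a b) (ha : ∀ t, 0 ≤ a t) : 0 ≤ b :=
  multiplier_nonneg fun φ => by
    rw [h.extend_eq]
    exact integral_nonneg fun t => (extend φ).map_nonneg (ha t)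

theorem mono (h : HasFieldIntegral μ a b) (h' : HasFieldIntegral μ a' b')
    (hle : ∀ t, a t ≤ a' t) : b ≤ b' :=
  sub_nonneg.1 <| (h'.sub h).nonneg fun t => sub_nonneg.2 (hle t)

/-- The integral of a field commutes with everything that commutes with the field. -/
theorem commute (h : HasFieldIntegral μ a b) {c : 𝓜(ℂ, A)} (hc : ∀ t, Commute (a t) c) :
    Commute b c := by
  have h1 := h.mul_right c
  simp only [(hc _).eq] at h1
  exact h1.unique (h.mul_left c)

end HasFieldIntegral

theorem FieldIntegrable.hasFieldIntegral {a : T → 𝓜(ℂ, A)} (h : FieldIntegrable μ a) :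
    HasFieldIntegral μ a (fieldIntegral μ a) := by
  rw [fieldIntegral, dif_pos h]
  exact h.choose_spec

end FieldIntegral

/-! ### Strong measurability in separable algebras -/

section ConjElem

variable {A : Type*} [NonUnitalCStarAlgebra A]

/-- The element `a* x a` of the ideal `A` of its multiplier algebra. -/
noncomputable def conjElem (a : 𝓜(ℂ, A)) (x : A) : A := (star a).fst (a.snd x)

theorem coe_conjElem (a : 𝓜(ℂ, A)) (x : A) :
    ((conjElem a x : A) : 𝓜(ℂ, A)) = star a * (x : 𝓜(ℂ, A)) * a := by
  rw [conjElem, ← mul_coe, ← coe_mul_multiplier, mul_assoc]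

end ConjElem

section Measurability

variable {A : Type*} [NonUnitalCStarAlgebra A] [PartialOrder A] [StarOrderedRing A]

/-- A separable C⋆-algebra has a faithful positive functional: a weighted sum of countably many
positive functionals which separate the points (these exist by the Lindelöf property). -/
theorem exists_faithful [TopologicalSpace.SeparableSpace A] :
    ∃ φ : A →ₚ[ℂ] ℂ, ∀ d : A, φ (star d * d) = 0 → d = 0 := by
  have : SecondCountableTopology A := UniformSpace.secondCountable_of_separable A
  obtain ⟨Φ, hΦc, hΦ⟩ := TopologicalSpace.isOpen_iUnion_countable
    (fun φ : A →ₚ[ℂ] ℂ => {a : A | φ a ≠ 0})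
    (fun φ => isOpen_ne_fun (map_continuous φ) continuous_const)
  obtain ⟨ψ, hψ⟩ := (hΦc.insert 0).exists_eq_range (Set.insert_nonempty _ _)
  choose C hC using fun n => PositiveLinearMap.exists_norm_apply_le (ψ n)
  have hsep : ∀ d : A, (∀ n, ψ n d = 0) → d = 0 := by
    intro d hd
    refine eq_zero_of_forall_positive fun φ => ?_
    by_contra hne
    have h1 : d ∈ ⋃ φ : A →ₚ[ℂ] ℂ, {a : A | φ a ≠ 0} := Set.mem_iUnion.2 ⟨φ, hne⟩
    rw [← hΦ] at h1
    obtain ⟨φ', hφ', h2⟩ := Set.mem_iUnion₂.1 h1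
    obtain ⟨n, rfl⟩ : φ' ∈ Set.range ψ := hψ ▸ Set.mem_insert_of_mem _ hφ'
    exact h2 (hd n)
  let w : ℕ → ℂ := fun n => (((1 / 2 : ℝ) ^ n / (C n + 1) : ℝ) : ℂ)
  have hw : ∀ n, 0 < w n := fun n => by
    have : (0 : ℝ) < (1 / 2 : ℝ) ^ n / (C n + 1) := by positivity
    exact Complex.zero_lt_real.2 this
  have hsum : ∀ d, Summable fun n => w n * ψ n d := by
    intro d
    refine Summable.of_norm_bounded
      (summable_geometric_two.mul_right ‖d‖) fun n => ?_
    rw [norm_mul, Complex.norm_of_nonneg (by positivity)]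
    calc (1 / 2 : ℝ) ^ n / (C n + 1) * ‖ψ n d‖
        ≤ (1 / 2 : ℝ) ^ n / (C n + 1) * ((C n + 1) * ‖d‖) := by
          gcongr
          refine (hC n d).trans ?_
          gcongr
          linarith
      _ = (1 / 2 : ℝ) ^ n * ‖d‖ := by
          have : (C n : ℝ) + 1 ≠ 0 := by positivity
          field_simp
  have hterm : ∀ d : A, 0 ≤ d → ∀ n, 0 ≤ w n * ψ n d := fun d hd n =>
    mul_nonneg (hw n).le ((ψ n).map_nonneg hd)
  refine ⟨PositiveLinearMap.mk₀
    { toFun := fun d => ∑' n, w n * ψ n d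
      map_add' := fun c d => by
        simp only [map_add, mul_add]
        exact (hsum c).tsum_add (hsum d)
      map_smul' := fun r d => by
        simp only [map_smul, smul_eq_mul, RingHom.id_apply, mul_left_comm _ r]
        exact tsum_mul_left }
    fun d hd => tsum_nonneg (hterm d hd), fun d hd => ?_⟩
  have hd : ∑' n, w n * ψ n (star d * d) = 0 := hd
  refine (CStarRing.star_mul_self_eq_zero_iff _).1 (hsep _ fun n => ?_)
  have h1 := (hsum (star d * d)).le_tsum n fun m _ => hterm _ (star_mul_self_nonneg d) m
  rw [hd] at h1
  have h2 := le_antisymm h1 (hterm _ (star_mul_self_nonneg d) n)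
  exact (mul_eq_zero.1 h2).resolve_left (hw n).ne'

variable {T : Type*} [MeasurableSpace T] {μ : Measure T}

/-- Pettis' measurability theorem, tested on the functionals `φ(d* ·)`. For a single faithful `φ`
and a dense sequence of `d` these give a continuous injection of `A` into the Polish space of
complex sequences, which is a measurable embedding by the Lusin–Souslin theorem. -/
theorem aestronglyMeasurable_of_forall [TopologicalSpace.SeparableSpace A] {x : T → A}
    (h : ∀ (φ : A →ₚ[ℂ] ℂ) (d : A), AEStronglyMeasurable (fun t => φ (star d * x t)) μ) :
    AEStronglyMeasurable x μ := by
  have : SecondCountableTopology A := UniformSpace.secondCountable_of_separable A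
  borelize A
  obtain ⟨φ, hφ⟩ := exists_faithful (A := A)
  let p : A → ℕ → ℂ := fun c n => φ (star (TopologicalSpace.denseSeq A n) * c)
  have hp : Continuous p := continuous_pi fun n =>
    (map_continuous φ).comp (continuous_const.mul continuous_id)
  have hinj : Function.Injective p := by
    intro c c' hcc
    refine sub_eq_zero.1 (hφ _ ?_)
    have h1 : ∀ d : A, φ (star d * (c - c')) = 0 := by
      intro d
      have hcl : IsClosed {d : A | φ (star d * (c - c')) = 0} :=
        isClosed_eq ((map_continuous φ).comp (continuous_star.mul continuous_const))
          continuous_const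
      refine (TopologicalSpace.denseRange_denseSeq A).induction_on
        (p := fun d => φ (star d * (c - c')) = 0) d hcl fun n => ?_
      rw [mul_sub, map_sub, sub_eq_zero]
      exact congrFun hcc n
    exact h1 _
  have hemb : MeasurableEmbedding p := hp.measurableEmbedding hinj
  refine AEMeasurable.aestronglyMeasurable (hemb.aemeasurable_comp_iff.1 ?_)
  exact aemeasurable_pi_iff.2 fun n => (h φ _).aemeasurable

namespace WeakStarMeasurable

variable {m : T → 𝓜(ℂ, A)}

theorem conj (hm : WeakStarMeasurable μ m) (c : 𝓜(ℂ, A)) :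
    WeakStarMeasurable μ (fun t => star c * m t * c) := fun φ => by
  simp only [← extend_apply, ← extend_conjFunctional]
  exact hm _

theorem star_mul_mul (hm : WeakStarMeasurable μ m) (d c : 𝓜(ℂ, A)) :
    WeakStarMeasurable μ (fun t => star d * m t * c) := fun φ => by
  have h := fun e => hm.conj e φ
  simp only [← extend_apply] at h ⊢
  simp only [polarization c d, map_smul, map_add, map_sub]
  exact ((((h _).sub (h _)).add ((h _).const_smul Complex.I)).sub
    ((h _).const_smul Complex.I)).const_smul (4⁻¹ : ℂ)

protected theorem star (hm : WeakStarMeasurable μ m) :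
    WeakStarMeasurable μ (fun t => star (m t)) := fun φ => by
  simp only [← extend_apply, map_star]
  exact continuous_star.comp_aestronglyMeasurable (hm φ)

variable [TopologicalSpace.SeparableSpace A]

theorem aestronglyMeasurable_of_coe {x : T → A}
    (hx : WeakStarMeasurable μ fun t => (x t : 𝓜(ℂ, A))) : AEStronglyMeasurable x μ :=
  aestronglyMeasurable_of_forall fun φ d => by
    have := hx.star_mul_mul (d : 𝓜(ℂ, A)) 1 φ
    simpa only [mul_one, ← coe_star', ← coe_mul', multExt_coe] using this

theorem aestronglyMeasurable_fst_const (hm : WeakStarMeasurable μ m) (c : A) :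
    AEStronglyMeasurable (fun t => (m t).fst c) μ :=
  aestronglyMeasurable_of_forall fun φ d => by
    have := hm.star_mul_mul (d : 𝓜(ℂ, A)) c φ
    have h1 : ∀ t, star (d : 𝓜(ℂ, A)) * m t * c = (star d * (m t).fst c : A) := fun t => by
      rw [mul_assoc, mul_coe, coe_mul', coe_star']
    simpa only [h1, multExt_coe] using this

/-- The field `m x` is measurable since `φ(d* m x) = φ((m* d)* x)` comes from a product of two
measurable fields in `A`. -/
theorem aestronglyMeasurable_fst (hm : WeakStarMeasurable μ m) {x : T → A}
    (hx : AEStronglyMeasurable x μ) : AEStronglyMeasurable (fun t => (m t).fst (x t)) μ :=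
  aestronglyMeasurable_of_forall fun φ d => by
    have h1 := hm.star.aestronglyMeasurable_fst_const d
    have h2 : ∀ t, star d * (m t).fst (x t) = star ((star (m t)).fst d) * x t := fun t => by
      rw [← (m t).central]; simp
    simp only [h2]
    exact (map_continuous φ).comp_aestronglyMeasurable
      ((continuous_star.comp_aestronglyMeasurable h1).mul hx)

end WeakStarMeasurable

theorem aestronglyMeasurable_conjElem [TopologicalSpace.SeparableSpace A] {a : T → 𝓜(ℂ, A)}
    (ha : WeakStarMeasurable μ a) {x : T → A} (hx : AEStronglyMeasurable x μ) :
    AEStronglyMeasurable (fun t => conjElem (a t) (x t)) μ := by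
  refine ha.star.aestronglyMeasurable_fst ?_
  have h1 := continuous_star.comp_aestronglyMeasurable
    (ha.star.aestronglyMeasurable_fst (continuous_star.comp_aestronglyMeasurable hx))
  simpa using h1

end Measurability

/-! ### Cauchy–Schwarz estimates for compressions -/

section Estimates

section

variable {A : Type*} [NonUnitalCStarAlgebra A] [PartialOrder A]

theorem re_nonneg (φ : A →ₚ[ℂ] ℂ) {a : A} (ha : 0 ≤ a) : 0 ≤ (φ a).re :=
  (Complex.nonneg_iff.1 (φ.map_nonneg ha)).1

theorem ofReal_re_eq (φ : A →ₚ[ℂ] ℂ) {a : A} (ha : 0 ≤ a) : ((φ a).re : ℂ) = φ a :=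
  Complex.ext rfl (by simpa using (Complex.nonneg_iff.1 (φ.map_nonneg ha)).2)

theorem norm_eq_re (φ : A →ₚ[ℂ] ℂ) {a : A} (ha : 0 ≤ a) : ‖φ a‖ = (φ a).re := by
  rw [← ofReal_re_eq φ ha, Complex.norm_real, Real.norm_of_nonneg (re_nonneg φ ha)]; simp

variable [StarOrderedRing A]

theorem re_mono (φ : A →ₚ[ℂ] ℂ) {a b : A} (h : a ≤ b) : (φ a).re ≤ (φ b).re := by
  have := re_nonneg φ (sub_nonneg.2 h)
  rw [map_sub, Complex.sub_re] at this
  linarith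

end

/-- The optimization in `r` which turns a sum of weighted terms into a product (arithmetic-geometric
mean inequality), through the discriminant. -/
theorem sq_le_of_forall_pos {x C p q : ℝ} (hx : 0 ≤ x) (hC : 0 ≤ C) (hp : 0 ≤ p) (hq : 0 ≤ q)
    (h : ∀ r > 0, x ≤ C * r * p + C / r * q) : x ^ 2 ≤ 4 * C ^ 2 * p * q := by
  have h1 : discrim (C * p) (-x) (C * q) ≤ 0 := by
    refine discrim_le_zero fun r => ?_
    rcases le_or_gt r 0 with hr | hr
    · have : 0 ≤ (C * p) * (r * r) := mul_nonneg (mul_nonneg hC hp) (mul_self_nonneg r)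
      have : 0 ≤ C * q := mul_nonneg hC hq
      nlinarith
    · have h2 := mul_le_mul_of_nonneg_left (h r hr) hr.le
      have h3 : r * (C * r * p + C / r * q) = C * p * (r * r) + C * q := by field_simp
      linarith
  rw [discrim] at h1
  nlinarith

/-- Cauchy–Schwarz for `d* a* x a c`, in additive form so that it can be integrated termwise. -/
theorem norm_conj_le {A : Type*} [NonUnitalCStarAlgebra A] (φ : 𝓜(ℂ, A) →ₚ[ℂ] ℂ)
    (a x d c : 𝓜(ℂ, A)) {C : ℝ} (hx : ‖x‖ ≤ C) {r : ℝ} (hr : 0 < r) :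
    ‖φ (star d * (star a * x * a) * c)‖ ≤
      C * r * (φ (star d * (star a * a) * d)).re + C / r * (φ (star c * (star a * a) * c)).re := by
  have hC : 0 ≤ C := (norm_nonneg x).trans hx
  have h1 := norm_apply_star_mul_sq_le φ (a * d) (x * (a * c))
  have e1 : star (a * d) * (x * (a * c)) = star d * (star a * x * a) * c := by
    simp only [star_mul, mul_assoc]
  have e2 : star (a * d) * (a * d) = star d * (star a * a) * d := by
    simp only [star_mul, mul_assoc]
  have e3 : star (x * (a * c)) * (x * (a * c)) = star (a * c) * (star x * x) * (a * c) := by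
    simp only [star_mul, mul_assoc]
  have e4 : star (a * c) * (a * c) = star c * (star a * a) * c := by
    simp only [star_mul, mul_assoc]
  have hp : 0 ≤ star d * (star a * a) * d := e2 ▸ star_mul_self_nonneg _
  have hq : 0 ≤ star c * (star a * a) * c := e4 ▸ star_mul_self_nonneg _
  have hb := CStarAlgebra.star_left_conjugate_le_norm_smul (a := a * c) (b := star x * x)
  rw [e4, CStarRing.norm_star_mul_self] at hb
  rw [e1, e2, e3, norm_eq_re φ hp, norm_eq_re φ (star_left_conjugate_nonneg
    (star_mul_self_nonneg x) _)] at h1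
  have h2 := re_mono φ hb
  rw [PositiveLinearMap.map_smul_of_tower, Complex.smul_re, smul_eq_mul] at h2
  set P := (φ (star d * (star a * a) * d)).re
  set Q := (φ (star c * (star a * a) * c)).re
  have hP : 0 ≤ P := re_nonneg φ hp
  have hQ : 0 ≤ Q := re_nonneg φ hq
  have h3 : ‖φ (star d * (star a * x * a) * c)‖ ^ 2 ≤ P * (C * C * Q) := by
    refine h1.trans (mul_le_mul_of_nonneg_left (h2.trans ?_) hP)
    gcongr
  refine abs_le_of_sq_le_sq' (h3.trans ?_) (by positivity) |>.2
  have h4 : (C * r * P + C / r * Q) ^ 2 = (C * r * P - C / r * Q) ^ 2 + 4 * (P * (C * C * Q)) := by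
    field_simp
    ring
  have : 0 ≤ P * (C * C * Q) := by positivity
  rw [h4]
  nlinarith [sq_nonneg (C * r * P - C / r * Q)]

end Estimates

section CompressionEstimates

variable {A : Type*} [NonUnitalCStarAlgebra A] [PartialOrder A] [StarOrderedRing A]
variable {T : Type*} [MeasurableSpace T] {μ : Measure T}

section

variable {a : T → 𝓜(ℂ, A)} {z : 𝓜(ℂ, A)} {x : T → A} {C : ℝ}

/-- Integrated form of the Cauchy–Schwarz estimate. The weight `ρ` enters on the right in the second
factor only, so the increments of truncated integrals are controlled by those of `∫ ρ c* a* a c`. -/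
theorem norm_integral_conj_sq_le (hz : HasFieldIntegral μ (fun t => star (a t) * a t) z)
    (hx : ∀ t, ‖x t‖ ≤ C) (hC : 0 ≤ C) (φ : A →ₚ[ℂ] ℂ) (d c : 𝓜(ℂ, A)) {ρ : T → ℝ}
    (hρ : AEStronglyMeasurable ρ μ) (h0 : ∀ t, 0 ≤ ρ t) (h1 : ∀ t, ρ t ≤ 1) :
    ‖∫ t, ρ t • extend φ (star d * (conjElem (a t) (x t) : A) * c) ∂μ‖ ^ 2 ≤
      4 * C ^ 2 * (extend φ (star d * z * d)).re *
        ∫ t, ρ t * (extend φ (star c * (star (a t) * a t) * c)).re ∂μ := by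
  have hP := (hz.conj d).integrable φ
  have hQ := (hz.conj c).integrable φ
  have hPn : ∀ (c : 𝓜(ℂ, A)) t, 0 ≤ (extend φ (star c * (star (a t) * a t) * c)).re := fun c t =>
    re_nonneg _ (star_left_conjugate_nonneg (star_mul_self_nonneg _) _)
  have hρQ : Integrable (fun t => ρ t * (extend φ (star c * (star (a t) * a t) * c)).re) μ :=
    hQ.re.bdd_mul hρ (c := 1) (Eventually.of_forall fun t => by
      rw [Real.norm_of_nonneg (h0 t)]; exact h1 t)
  have hPe : (extend φ (star d * z * d)).re =
      ∫ t, (extend φ (star d * (star (a t) * a t) * d)).re ∂μ := by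
    rw [(hz.conj d).extend_eq]
    exact (integral_re hP).symm
  have hPr : Integrable (fun t => (extend φ (star d * (star (a t) * a t) * d)).re) μ := hP.re
  rw [hPe]
  refine sq_le_of_forall_pos (norm_nonneg _) hC (integral_nonneg (hPn d))
    (integral_nonneg fun t => mul_nonneg (h0 t) (hPn c t)) fun r hr => ?_
  rw [← integral_const_mul, ← integral_const_mul, ← integral_add (hPr.const_mul _)
    (hρQ.const_mul _)]
  refine norm_integral_le_of_norm_le ((hPr.const_mul _).add (hρQ.const_mul _))
    (Eventually.of_forall fun t => ?_)
  rw [norm_smul, Real.norm_of_nonneg (h0 t), coe_conjElem]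
  have h2 := norm_conj_le (extend φ) (a t) (x t) d c (C := C) (by rw [norm_coe']; exact hx t) hr
  have h3 : ρ t * (C * r * (extend φ (star d * (star (a t) * a t) * d)).re) ≤
      C * r * (extend φ (star d * (star (a t) * a t) * d)).re :=
    mul_le_of_le_one_left (mul_nonneg (by positivity) (hPn d t)) (h1 t)
  calc _ ≤ ρ t * _ := mul_le_mul_of_nonneg_left h2 (h0 t)
    _ ≤ _ := by
      rw [mul_add]
      refine (add_le_add_left h3 _).trans (le_of_eq ?_)
      ring

variable [TopologicalSpace.SeparableSpace A]

theorem integrable_conj (ha : WeakStarMeasurable μ a)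
    (hz : HasFieldIntegral μ (fun t => star (a t) * a t) z) (hxm : AEStronglyMeasurable x μ)
    (hx : ∀ t, ‖x t‖ ≤ C) (φ : A →ₚ[ℂ] ℂ) (d c : 𝓜(ℂ, A)) :
    Integrable (fun t => extend φ (star d * (conjElem (a t) (x t) : A) * c)) μ := by
  refine (((((hz.conj d).integrable φ).re.const_mul (C * 1))).add
    (((hz.conj c).integrable φ).re.const_mul (C / 1))).mono' ?_ (Eventually.of_forall fun t => ?_)
  · have h1 : WeakStarMeasurable μ fun t => ((conjElem (a t) (x t) : A) : 𝓜(ℂ, A)) := fun φ => by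
      simp only [multExt_coe]
      exact (map_continuous φ).comp_aestronglyMeasurable (aestronglyMeasurable_conjElem ha hxm)
    exact h1.star_mul_mul d c φ
  · rw [coe_conjElem]
    exact norm_conj_le (extend φ) (a t) (x t) d c (C := C) (by rw [norm_coe']; exact hx t)
      one_pos

omit [TopologicalSpace.SeparableSpace A] in
/-- In the hypothesis `v` appears on both sides, as it does when Cauchy–Schwarz is applied to a
vector `v` tested against itself; one factor `φ(v* v)` is cancelled. -/
theorem star_mul_self_le_of_forall (hz0 : 0 ≤ z) {v s : A} (hs : 0 ≤ s)
    (H : ∀ φ : A →ₚ[ℂ] ℂ, ‖φ (star v * v)‖ ^ 2 ≤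
      4 * C ^ 2 * (extend φ (star (v : 𝓜(ℂ, A)) * z * v)).re * (φ s).re) :
    star v * v ≤ (4 * C ^ 2 * ‖z‖) • s := by
  refine le_of_forall_positive (.star_mul_self v)
    (IsSelfAdjoint.smul (by simp [IsSelfAdjoint]) (.of_nonneg hs)) fun φ => ?_
  have hv := star_mul_self_nonneg v
  have h1 := H φ
  have h2 := re_mono (extend φ) (CStarAlgebra.star_left_conjugate_le_norm_smul
    (a := (v : 𝓜(ℂ, A))) (b := z) (IsSelfAdjoint.of_nonneg hz0))
  rw [PositiveLinearMap.map_smul_of_tower, Complex.smul_re, smul_eq_mul, ← coe_star',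
    ← coe_mul', extend_coe] at h2
  rw [PositiveLinearMap.map_smul_of_tower, ← ofReal_re_eq φ hv, ← ofReal_re_eq φ hs,
    Complex.real_smul, ← Complex.ofReal_mul, Complex.real_le_real]
  rw [norm_eq_re φ hv, ← coe_star'] at h1
  have hv' := re_nonneg φ hv
  have hs' := re_nonneg φ hs
  set p := (φ (star v * v)).re
  set q := (φ s).re
  have h3 : p * p ≤ (4 * C ^ 2 * ‖z‖ * q) * p := by
    calc p * p = p ^ 2 := by ring
      _ ≤ 4 * C ^ 2 * (‖z‖ * p) * q := h1.trans (by gcongr)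
      _ = _ := by ring
  rcases hv'.eq_or_lt with h0 | h0
  · rw [← h0]; positivity
  · exact le_of_mul_le_mul_right h3 h0

omit [TopologicalSpace.SeparableSpace A] in
theorem integral_apply (φ : A →ₚ[ℂ] ℂ) {f : T → A} (hf : Integrable f μ) :
    ∫ t, φ (f t) ∂μ = φ (∫ t, f t ∂μ) :=
  let Φ : A →L[ℂ] ℂ := ⟨φ.toLinearMap, map_continuous φ⟩
  Φ.integral_comp_comm hf

omit [TopologicalSpace.SeparableSpace A] in
theorem integrable_apply (φ : A →ₚ[ℂ] ℂ) {f : T → A} (hf : Integrable f μ) :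
    Integrable (fun t => φ (f t)) μ :=
  let Φ : A →L[ℂ] ℂ := ⟨φ.toLinearMap, map_continuous φ⟩
  Φ.integrable_comp hf

omit [TopologicalSpace.SeparableSpace A] in
theorem integral_apply_mul (φ : A →ₚ[ℂ] ℂ) (d : A) {f : T → A} (hf : Integrable f μ) :
    ∫ t, φ (d * f t) ∂μ = φ (d * ∫ t, f t ∂μ) :=
  let Φ : A →L[ℂ] ℂ := ⟨φ.toLinearMap, map_continuous φ⟩
  (Φ.comp (ContinuousLinearMap.mul ℂ A d)).integral_comp_comm hf

omit [TopologicalSpace.SeparableSpace A] in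
theorem integrable_apply_mul (φ : A →ₚ[ℂ] ℂ) (d : A) {f : T → A} (hf : Integrable f μ) :
    Integrable (fun t => φ (d * f t)) μ :=
  let Φ : A →L[ℂ] ℂ := ⟨φ.toLinearMap, map_continuous φ⟩
  (Φ.comp (ContinuousLinearMap.mul ℂ A d)).integrable_comp hf

end

end CompressionEstimates

/-! ### Integrals of compressions of bounded fields -/

section Existence

variable {A : Type*} [NonUnitalCStarAlgebra A] [PartialOrder A] [StarOrderedRing A]
variable {T : Type*} [MeasurableSpace T] {μ : Measure T}
variable {a : T → 𝓜(ℂ, A)} {z : 𝓜(ℂ, A)} {x : T → A} {C : ℝ}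

theorem extend_star_coe_mul (φ : A →ₚ[ℂ] ℂ) (d b c : A) :
    extend φ (star (d : 𝓜(ℂ, A)) * (b : 𝓜(ℂ, A)) * c) = φ (star d * (b * c)) := by
  rw [← coe_star', ← coe_mul', ← coe_mul', extend_coe, mul_assoc]

theorem extend_star_coe_mul_fst (φ : A →ₚ[ℂ] ℂ) (d c : A) (m : 𝓜(ℂ, A)) :
    extend φ (star (d : 𝓜(ℂ, A)) * m * c) = φ (star d * m.fst c) := by
  rw [mul_assoc, mul_coe, ← coe_star', ← coe_mul', extend_coe]

variable [TopologicalSpace.SeparableSpace A]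

/-- For each vector `c` the weak integral of `a* x a c` is represented by an element of `A`. The
field need not be Bochner integrable, but its truncations `ρ k • a* x a c` are, and the squared
increments of their integrals `V k` are bounded by increments of `S k = ∫ ρ k • c* a* a c`. The
latter increase weakly to `c* z c`, hence converge in norm. -/
theorem exists_integral_vector (ha : WeakStarMeasurable μ a)
    (hz : HasFieldIntegral μ (fun t => star (a t) * a t) z) (hxm : AEStronglyMeasurable x μ)
    (hx : ∀ t, ‖x t‖ ≤ C) (hC : 0 ≤ C) (c : A) :
    ∃ v : A, ∀ (φ : A →ₚ[ℂ] ℂ) (d : A),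
      φ (star d * v) = ∫ t, φ (star d * (conjElem (a t) (x t) * c)) ∂μ := by
  have hz0 : 0 ≤ z := hz.nonneg fun t => star_mul_self_nonneg _
  obtain ⟨ψ, hψ⟩ := exists_faithful (A := A)
  set u : T → A := fun t => (a t).fst c with hu
  set w : T → A := fun t => star (u t) * u t with hw
  set f : T → A := fun t => conjElem (a t) (x t) * c with hf
  have hum : AEStronglyMeasurable u μ := ha.aestronglyMeasurable_fst_const c
  have hwm : AEStronglyMeasurable w μ := (continuous_star.comp_aestronglyMeasurable hum).mul hum
  have hfm : AEStronglyMeasurable f μ :=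
    (aestronglyMeasurable_conjElem ha hxm).mul_const c
  have hw0 : ∀ t, 0 ≤ w t := fun t => star_mul_self_nonneg _
  have hwz : ∀ (φ : A →ₚ[ℂ] ℂ) t, extend φ (star (c : 𝓜(ℂ, A)) * (star (a t) * a t) * c) =
      φ (w t) := fun φ t => by
    have h1 : star (c : 𝓜(ℂ, A)) * (star (a t) * a t) * c = ((w t : A) : 𝓜(ℂ, A)) := by
      rw [hw, hu, coe_mul', coe_star', ← mul_coe]
      simp only [star_mul, mul_assoc]
    rw [h1, extend_coe]
  have hfu : ∀ t, u t = 0 → f t = 0 := fun t ht => by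
    have h1 : ((f t : A) : 𝓜(ℂ, A)) = star (a t) * (x t : 𝓜(ℂ, A)) * (u t : A) := by
      have h2 : ((u t : A) : 𝓜(ℂ, A)) = a t * (c : 𝓜(ℂ, A)) := (mul_coe _ _).symm
      rw [h2, hf, coe_mul', coe_conjElem, mul_assoc]
    rw [ht, coe_zero', mul_zero, ← coe_zero'] at h1
    exact coe_injective' h1
  have hwi : ∀ φ : A →ₚ[ℂ] ℂ, Integrable (fun t => φ (w t)) μ := fun φ => by
    simpa only [hwz] using (hz.conj (c : 𝓜(ℂ, A))).integrable φ
  set L : A := star c * z.fst c with hL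
  have hwL : ∀ φ : A →ₚ[ℂ] ℂ, ∫ t, φ (w t) ∂μ = φ L := fun φ => by
    have h1 := (hz.conj (c : 𝓜(ℂ, A))).extend_eq φ
    simp only [hwz] at h1
    rw [← h1, extend_star_coe_mul_fst]
  have hLsa : IsSelfAdjoint L := by
    refine IsSelfAdjoint.of_nonneg (nonneg_of_forall_positive ?_ fun φ => ?_)
    · refine coe_injective' ?_
      change ((star L : A) : 𝓜(ℂ, A)) = ((L : A) : 𝓜(ℂ, A))
      rw [coe_star', hL, coe_mul', coe_star', ← mul_coe]
      simp [mul_assoc, (IsSelfAdjoint.of_nonneg hz0).star_eq]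
    · rw [← hwL]
      exact integral_nonneg fun t => φ.map_nonneg (hw0 t)
  -- The weights make `ρ k • w` and `ρ k • f` dominated by `k * g`, with `g` integrable, and
  -- increase to `1` where `u ≠ 0` because `ψ` is faithful; where `u = 0`, both `w` and `f` vanish.
  set g : T → ℝ := fun t => (ψ (w t)).re with hg
  have hg0 : ∀ t, 0 ≤ g t := fun t => re_nonneg ψ (hw0 t)
  have hgi : Integrable g μ := (hwi ψ).re
  have hgpos : ∀ t, u t ≠ 0 → 0 < g t := fun t ht => by
    refine (hg0 t).lt_of_ne fun h => ht (hψ _ ?_)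
    rw [← ofReal_re_eq ψ (hw0 t)]
    exact_mod_cast h.symm
  set N : T → ℝ := fun t => ‖w t‖ + ‖f t‖ with hN
  have hN0 : ∀ t, 0 ≤ N t := fun t => by positivity
  set ρ : ℕ → T → ℝ := fun k t => min 1 (k * g t / N t) with hρ
  have hρm : ∀ k, AEStronglyMeasurable (ρ k) μ := fun k => by
    have h1 : AEMeasurable (fun t => (k * g t / N t : ℝ)) μ :=
      (hgi.aestronglyMeasurable.aemeasurable.const_mul _).div
        (hwm.norm.aemeasurable.add hfm.norm.aemeasurable)
    exact (aemeasurable_const.min h1).aestronglyMeasurable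
  have hρ0 : ∀ k t, 0 ≤ ρ k t := fun k t =>
    le_min zero_le_one (div_nonneg (mul_nonneg k.cast_nonneg (hg0 t)) (hN0 t))
  have hρ1 : ∀ k t, ρ k t ≤ 1 := fun k t => min_le_left _ _
  have hρmono : ∀ t, Monotone fun k => ρ k t := fun t k l hkl => by
    refine min_le_min_left _ (div_le_div_of_nonneg_right ?_ (hN0 t))
    exact mul_le_mul_of_nonneg_right (Nat.cast_le.2 hkl) (hg0 t)
  have hρN : ∀ k t, ρ k t * N t ≤ k * g t := fun k t => by
    rcases (hN0 t).eq_or_lt with h0 | h0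
    · rw [← h0, mul_zero]; exact mul_nonneg k.cast_nonneg (hg0 t)
    · exact (mul_le_mul_of_nonneg_right (min_le_right _ _) h0.le).trans
        (div_mul_cancel₀ _ h0.ne').le
  have hρlim : ∀ t, u t ≠ 0 → Tendsto (fun k => ρ k t) atTop (𝓝 1) := fun t ht => by
    have hNp : 0 < N t := by
      have : w t ≠ 0 := fun h => ht ((CStarRing.star_mul_self_eq_zero_iff _).1 h)
      exact add_pos_of_pos_of_nonneg (norm_pos_iff.2 this) (norm_nonneg _)
    refine tendsto_const_nhds.congr' ?_
    have h1 : Tendsto (fun k : ℕ => (k : ℝ) * (g t / N t)) atTop atTop :=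
      tendsto_natCast_atTop_atTop.atTop_mul_const (div_pos (hgpos t ht) hNp)
    filter_upwards [h1.eventually_ge_atTop 1] with k hk
    rw [← mul_div_assoc] at hk
    exact (min_eq_left hk).symm
  have hlim : ∀ (F : Type _) [NormedAddCommGroup F] [NormedSpace ℝ F] (h : T → F),
      (∀ t, u t = 0 → h t = 0) → ∀ t, Tendsto (fun k => ρ k t • h t) atTop (𝓝 (h t)) := by
    intro F _ _ h h0 t
    by_cases ht : u t = 0
    · simp [h0 t ht]
    · simpa using (hρlim t ht).smul_const (h t)
  have hρwi : ∀ k, Integrable (fun t => ρ k t • w t) μ := fun k => by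
    refine (hgi.const_mul (k : ℝ)).mono' ((hρm k).smul hwm) (Eventually.of_forall fun t => ?_)
    rw [norm_smul, Real.norm_of_nonneg (hρ0 k t)]
    refine le_trans ?_ (hρN k t)
    exact mul_le_mul_of_nonneg_left (le_add_of_nonneg_right (norm_nonneg _)) (hρ0 k t)
  have hρfi : ∀ k, Integrable (fun t => ρ k t • f t) μ := fun k => by
    refine (hgi.const_mul (k : ℝ)).mono' ((hρm k).smul hfm) (Eventually.of_forall fun t => ?_)
    rw [norm_smul, Real.norm_of_nonneg (hρ0 k t)]
    refine le_trans ?_ (hρN k t)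
    exact mul_le_mul_of_nonneg_left (le_add_of_nonneg_left (norm_nonneg _)) (hρ0 k t)
  set S : ℕ → A := fun k => ∫ t, ρ k t • w t ∂μ with hS
  set V : ℕ → A := fun k => ∫ t, ρ k t • f t ∂μ with hV
  have hSmono : Monotone S := fun k l hkl => integral_mono (hρwi k) (hρwi l) fun t =>
    smul_le_smul_of_nonneg_right (hρmono t hkl) (hw0 t)
  have hSsa : ∀ k, IsSelfAdjoint (S k) := fun k => IsSelfAdjoint.of_nonneg <|
    integral_nonneg fun t => smul_nonneg (hρ0 k t) (hw0 t)
  have hSφ : ∀ (φ : A →ₚ[ℂ] ℂ) k, φ (S k) = ∫ t, ρ k t • φ (w t) ∂μ := fun φ k => by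
    rw [hS, ← integral_apply φ (hρwi k)]
    simp only [PositiveLinearMap.map_smul_of_tower]
  have hVi : ∀ (φ : A →ₚ[ℂ] ℂ) (d : A) k, Integrable (fun t => ρ k t • φ (d * f t)) μ :=
    fun φ d k => by
      simpa only [PositiveLinearMap.map_smul_of_tower, mul_smul_comm] using
        integrable_apply_mul φ d (hρfi k)
  have hVφ : ∀ (φ : A →ₚ[ℂ] ℂ) (d : A) k, φ (d * V k) = ∫ t, ρ k t • φ (d * f t) ∂μ :=
    fun φ d k => by
      rw [hV, ← integral_apply_mul φ d (hρfi k)]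
      simp only [PositiveLinearMap.map_smul_of_tower, mul_smul_comm]
  have hSi : ∀ (φ : A →ₚ[ℂ] ℂ) k, Integrable (fun t => ρ k t * (φ (w t)).re) μ := fun φ k => by
    simpa using (integrable_apply φ (hρwi k)).re
  have hSre : ∀ (φ : A →ₚ[ℂ] ℂ) k, (φ (S k)).re = ∫ t, ρ k t * (φ (w t)).re ∂μ := fun φ k => by
    rw [hS, ← integral_apply φ (hρwi k)]
    refine (integral_re (integrable_apply φ (hρwi k))).symm.trans ?_
    simp
  have hSlim : Tendsto S atTop (𝓝 L) := by
    refine tendsto_of_monotone_of_forall_positive hSmono hSsa hLsa fun φ => ?_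
    simp only [hSφ, ← hwL]
    refine tendsto_integral_of_dominated_convergence (fun t => ‖φ (w t)‖)
      (fun k => (hρm k).smul (hwi φ).aestronglyMeasurable) (hwi φ).norm
      (fun k => Eventually.of_forall fun t => ?_) (Eventually.of_forall <|
        hlim ℂ (fun t => φ (w t)) fun t ht => by simp [hw, ht])
    rw [norm_smul, Real.norm_of_nonneg (hρ0 k t)]
    exact mul_le_of_le_one_left (norm_nonneg _) (hρ1 k t)
  have hVS : ∀ k l, k ≤ l →
      ‖V l - V k‖ * ‖V l - V k‖ ≤ 4 * C ^ 2 * ‖z‖ * ‖S l - S k‖ := by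
    intro k l hkl
    have hs : 0 ≤ S l - S k := sub_nonneg.2 (hSmono hkl)
    have h1 : star (V l - V k) * (V l - V k) ≤ (4 * C ^ 2 * ‖z‖) • (S l - S k) := by
      refine star_mul_self_le_of_forall hz0 hs fun φ => ?_
      have h2 := norm_integral_conj_sq_le hz hx hC φ ((V l - V k : A) : 𝓜(ℂ, A)) (c : 𝓜(ℂ, A))
        (ρ := fun t => ρ l t - ρ k t) ((hρm l).sub (hρm k))
        (fun t => sub_nonneg.2 (hρmono t hkl))
        (fun t => (sub_le_self _ (hρ0 k t)).trans (hρ1 l t))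
      simp only [extend_star_coe_mul, hwz] at h2
      have h3 : φ (star (V l - V k) * (V l - V k)) =
          ∫ t, (ρ l t - ρ k t) • φ (star (V l - V k) * f t) ∂μ := by
        rw [mul_sub, map_sub, hVφ, hVφ, ← integral_sub (hVi φ _ l) (hVi φ _ k)]
        simp only [sub_smul]
      have h5 : (φ (S l - S k)).re = ∫ t, (ρ l t - ρ k t) * (φ (w t)).re ∂μ := by
        rw [map_sub, Complex.sub_re, hSre, hSre, ← integral_sub (hSi φ l) (hSi φ k)]
        simp only [sub_mul]
      rw [h3, h5]
      exact h2
    rw [← CStarRing.norm_star_mul_self]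
    refine (CStarAlgebra.norm_le_norm_of_nonneg_of_le (star_mul_self_nonneg _) h1).trans ?_
    rw [norm_smul, Real.norm_of_nonneg (by positivity)]
  have hVc : CauchySeq V := by
    have hD : 0 ≤ 4 * C ^ 2 * ‖z‖ := by positivity
    refine Metric.cauchySeq_iff'.2 fun ε hε => ?_
    obtain ⟨k, hk⟩ := Metric.cauchySeq_iff'.1 hSlim.cauchySeq (ε ^ 2 / (4 * C ^ 2 * ‖z‖ + 1))
      (by positivity)
    refine ⟨k, fun l hl => ?_⟩
    have h1 := hVS k l hl
    have h2 := hk l hl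
    rw [dist_eq_norm, lt_div_iff₀ (by positivity)] at h2
    rw [dist_eq_norm]
    refine lt_of_pow_lt_pow_left₀ 2 hε.le ?_
    nlinarith [norm_nonneg (S l - S k)]
  obtain ⟨v, hv⟩ := cauchySeq_tendsto_of_complete hVc
  refine ⟨v, fun φ d => ?_⟩
  have hfi : Integrable (fun t => φ (star d * f t)) μ := by
    have h1 := integrable_conj ha hz hxm hx φ (d : 𝓜(ℂ, A)) (c : 𝓜(ℂ, A))
    simpa only [extend_star_coe_mul] using h1
  have h1 : Tendsto (fun k => φ (star d * V k)) atTop (𝓝 (φ (star d * v))) :=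
    ((map_continuous φ).tendsto _).comp (hv.const_mul (star d))
  refine tendsto_nhds_unique h1 ?_
  simp only [hVφ]
  refine tendsto_integral_of_dominated_convergence (fun t => ‖φ (star d * f t)‖)
    (fun k => (hρm k).smul hfi.aestronglyMeasurable) hfi.norm
    (fun k => Eventually.of_forall fun t => ?_) (Eventually.of_forall <|
      hlim ℂ (fun t => φ (star d * f t)) fun t ht => by simp [hfu t ht])
  rw [norm_smul, Real.norm_of_nonneg (hρ0 k t)]
  exact mul_le_of_le_one_left (norm_nonneg _) (hρ1 k t)

omit [TopologicalSpace.SeparableSpace A] in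
theorem eventually_star_eq : ∀ᶠ e : A in CStarAlgebra.approximateUnit A,
    star (e : 𝓜(ℂ, A)) = e := by
  filter_upwards [(CStarAlgebra.increasingApproximateUnit A).eventually_star_eq] with e he
  rw [← coe_star', he]

omit [TopologicalSpace.SeparableSpace A] in
/-- The functional `φ((1 - e)* z (1 - e))` vanishes along the approximate unit; this is what allows
one to replace vectors of `A` by the unit of the multiplier algebra. -/
theorem tendsto_one_sub_conj (φ : A →ₚ[ℂ] ℂ) (z : 𝓜(ℂ, A)) :
    Tendsto (fun e : A => extend φ (star (1 - (e : 𝓜(ℂ, A))) * z * (1 - (e : 𝓜(ℂ, A)))))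
      (CStarAlgebra.approximateUnit A) (𝓝 0) := by
  have h1 := tendsto_multExt_mul_approximateUnit_mul φ 1 z
  have h2 := tendsto_multExt_mul_approximateUnit_mul φ z 1
  simp only [one_mul, mul_one, ← extend_apply] at h1 h2
  have h3 : Tendsto (fun e : A => extend φ ((e : 𝓜(ℂ, A)) * z * (e : 𝓜(ℂ, A))))
      (CStarAlgebra.approximateUnit A) (𝓝 (extend φ z)) := by
    refine tendsto_multExt_of_strict φ (C := 1 * ‖z‖ * 1) ?_ fun d => ?_
    · filter_upwards [(CStarAlgebra.increasingApproximateUnit A).eventually_norm] with e he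
      rw [← norm_coe'] at he
      refine (norm_mul_le _ _).trans ?_
      gcongr
      refine (norm_mul_le _ _).trans ?_
      gcongr
    · have e1 : ∀ e : A, ((e : 𝓜(ℂ, A)) * z * (e : 𝓜(ℂ, A))).fst d =
          e * z.fst (e * d - d) + e * z.fst d := fun e => by
        simp [mul_sub]
      simp only [e1]
      have h4 := tendsto_mul_approximateUnit d
      have h5 : Tendsto (fun e : A => z.fst (e * d - d)) (CStarAlgebra.approximateUnit A)
          (𝓝 0) := by
        have := (z.fst.continuous.tendsto _).comp (h4.sub_const d)
        simpa [Function.comp_def] using this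
      rw [← zero_add (z.fst d)]
      refine Tendsto.add ?_ (by rw [zero_add]; exact tendsto_mul_approximateUnit _)
      refine squeeze_zero_norm' ?_ (tendsto_zero_iff_norm_tendsto_zero.1 h5)
      filter_upwards [(CStarAlgebra.increasingApproximateUnit A).eventually_norm] with e he
      exact (norm_mul_le _ _).trans (mul_le_of_le_one_left (norm_nonneg _) he)
  have h6 := ((tendsto_const_nhds (x := extend φ z)).sub h1).sub (h2.sub h3)
  simp only [sub_self] at h6
  refine h6.congr' ?_
  filter_upwards [eventually_star_eq (A := A)] with e he
  rw [star_sub, star_one, he]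
  simp only [sub_mul, mul_sub, one_mul, mul_one, map_sub]

/-- Let `a` be a column field with integrable squares. Then `a* x a` is integrable, for every
bounded, measurable field `x` of self-adjoint elements of `A`. The left action of the integral sends
`c` to the vector integral `v c` of `a* x a c`; self-adjointness of the field provides the right
action. -/
theorem exists_hasFieldIntegral_conj (ha : WeakStarMeasurable μ a)
    (hz : HasFieldIntegral μ (fun t => star (a t) * a t) z) (hxm : AEStronglyMeasurable x μ)
    (hxsa : ∀ t, IsSelfAdjoint (x t)) (hx : ∀ t, ‖x t‖ ≤ C) (hC : 0 ≤ C) :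
    ∃ y, HasFieldIntegral μ (fun t => star (a t) * (x t : 𝓜(ℂ, A)) * a t) y := by
  have hz0 : 0 ≤ z := hz.nonneg fun t => star_mul_self_nonneg _
  choose v hv using exists_integral_vector ha hz hxm hx hC
  set b : T → A := fun t => conjElem (a t) (x t) with hb
  have hbsa : ∀ t, star (b t) = b t := fun t => by
    refine coe_injective' ?_
    change ((star (b t) : A) : 𝓜(ℂ, A)) = ((b t : A) : 𝓜(ℂ, A))
    rw [coe_star', coe_conjElem]
    simp [mul_assoc, ← coe_star', (hxsa t).star_eq]
  have hJi : ∀ (φ : A →ₚ[ℂ] ℂ) (d c : 𝓜(ℂ, A)),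
      Integrable (fun t => extend φ (star d * (b t : 𝓜(ℂ, A)) * c)) μ := fun φ d c =>
    integrable_conj ha hz hxm hx φ d c
  have hJb : ∀ (φ : A →ₚ[ℂ] ℂ) (d c : 𝓜(ℂ, A)),
      ‖∫ t, extend φ (star d * (b t : 𝓜(ℂ, A)) * c) ∂μ‖ ^ 2 ≤
        4 * C ^ 2 * (extend φ (star d * z * d)).re * (extend φ (star c * z * c)).re := by
    intro φ d c
    have h1 := norm_integral_conj_sq_le hz hx hC φ d c (ρ := fun _ => 1)
      aestronglyMeasurable_const (fun _ => zero_le_one) (fun _ => le_rfl)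
    simp only [one_smul, one_mul] at h1
    have h2 : (extend φ (star c * z * c)).re =
        ∫ t, (extend φ (star c * (star (a t) * a t) * c)).re ∂μ := by
      rw [(hz.conj c).extend_eq]
      exact (integral_re ((hz.conj c).integrable φ)).symm
    rw [h2]
    exact h1
  have hfi : ∀ (φ : A →ₚ[ℂ] ℂ) (d c : A), Integrable (fun t => φ (star d * (b t * c))) μ :=
    fun φ d c => by
      simpa only [extend_star_coe_mul] using hJi φ (d : 𝓜(ℂ, A)) (c : 𝓜(ℂ, A))
  have hvuniq : ∀ v w : A, (∀ (φ : A →ₚ[ℂ] ℂ) (d : A), φ (star d * v) = φ (star d * w)) →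
      v = w := fun v w h => eq_of_forall_mul_left_eq fun d => eq_of_forall_positive fun φ => by
    simpa using h φ (star d)
  have hvadd : ∀ c d, v (c + d) = v c + v d := fun c d => hvuniq _ _ fun φ e => by
    simp only [hv, mul_add, map_add]
    exact integral_add (hfi φ e c) (hfi φ e d)
  have hvsmul : ∀ (r : ℂ) c, v (r • c) = r • v c := fun r c => hvuniq _ _ fun φ e => by
    simp only [hv, mul_smul_comm, map_smul]
    exact integral_smul _ _
  have hvstar : ∀ d c, star (v d) * c = star d * v c := fun d c => eq_of_forall_positive fun φ => by
    have h1 : star (v d) * c = star (star c * v d) := by simp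
    rw [h1, map_star, hv, hv, RCLike.star_def, ← integral_conj]
    refine integral_congr_ae (Eventually.of_forall fun t => ?_)
    change star (φ (star c * (b t * d))) = φ (star d * (b t * c))
    rw [← map_star]
    simp [hbsa, mul_assoc]
  set K : ℝ := √(4 * C ^ 2 * ‖z‖ * ‖z‖) with hK
  have hvb : ∀ c, ‖v c‖ ≤ K * ‖c‖ := fun c => by
    have hs : 0 ≤ star c * z.fst c := by
      refine nonneg_of_forall_positive ?_ fun φ => ?_
      · refine coe_injective' ?_
        change ((star (star c * z.fst c) : A) : 𝓜(ℂ, A)) = ((star c * z.fst c : A) : 𝓜(ℂ, A))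
        rw [coe_star', coe_mul', coe_star', ← mul_coe]
        simp [mul_assoc, (IsSelfAdjoint.of_nonneg hz0).star_eq]
      · rw [← extend_star_coe_mul_fst]
        exact (extend φ).map_nonneg (star_left_conjugate_nonneg hz0 _)
    have h1 : star (v c) * v c ≤ (4 * C ^ 2 * ‖z‖) • (star c * z.fst c) := by
      refine star_mul_self_le_of_forall hz0 hs fun φ => ?_
      have h2 := hJb φ (v c : 𝓜(ℂ, A)) (c : 𝓜(ℂ, A))
      simp only [extend_star_coe_mul] at h2
      rw [← hv, extend_star_coe_mul_fst φ c c z] at h2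
      exact h2
    have h3 : ‖v c‖ * ‖v c‖ ≤ (4 * C ^ 2 * ‖z‖) * (‖c‖ * (‖z‖ * ‖c‖)) := by
      rw [← CStarRing.norm_star_mul_self]
      refine (CStarAlgebra.norm_le_norm_of_nonneg_of_le (star_mul_self_nonneg _) h1).trans ?_
      rw [norm_smul, Real.norm_of_nonneg (by positivity)]
      gcongr
      refine (norm_mul_le _ _).trans ?_
      rw [norm_star]
      gcongr
      exact norm_fst_apply_le z c
    refine le_of_sq_le_sq ?_ (by positivity)
    rw [mul_pow, hK, Real.sq_sqrt (by positivity)]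
    linarith
  let y : 𝓜(ℂ, A) :=
    { fst := LinearMap.mkContinuous { toFun := v, map_add' := hvadd, map_smul' := hvsmul } K hvb
      snd := LinearMap.mkContinuous
        { toFun := fun c => star (v (star c))
          map_add' := fun c d => by rw [star_add, hvadd, star_add]
          map_smul' := fun r c => by rw [star_smul, hvsmul, star_smul, star_star]; rfl } K
        fun c => by simpa using hvb (star c)
      central := fun c d => by
        change star (v (star c)) * d = c * v d
        rw [hvstar, star_star] }
  have hy : ∀ c, y.fst c = v c := fun c => rfl
  have hyd : ∀ (φ : A →ₚ[ℂ] ℂ) (d c : A), extend φ (star (d : 𝓜(ℂ, A)) * y * c) =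
      ∫ t, extend φ (star (d : 𝓜(ℂ, A)) * (b t : 𝓜(ℂ, A)) * c) ∂μ := fun φ d c => by
    rw [extend_star_coe_mul_fst, hy, hv]
    simp only [extend_star_coe_mul, hb]
  -- passage from vectors to the unit of the multiplier algebra
  have hsq : ∀ (F : A → ℂ), Tendsto (fun e => ‖F e‖ ^ 2) (CStarAlgebra.approximateUnit A) (𝓝 0) →
      Tendsto F (CStarAlgebra.approximateUnit A) (𝓝 0) := fun F hF => by
    rw [tendsto_zero_iff_norm_tendsto_zero]
    simpa using hF.sqrt
  have hre := fun φ : A →ₚ[ℂ] ℂ =>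
    (Complex.continuous_re.tendsto 0).comp (tendsto_one_sub_conj φ z)
  simp only [Complex.zero_re] at hre
  have hy1 : ∀ (φ : A →ₚ[ℂ] ℂ) (c : A), extend φ (y * c) =
      ∫ t, extend φ ((b t : 𝓜(ℂ, A)) * c) ∂μ := fun φ c => by
    have h1 : Tendsto (fun e : A => ∫ t, extend φ (star (1 - (e : 𝓜(ℂ, A))) * (b t : 𝓜(ℂ, A)) * c)
        ∂μ) (CStarAlgebra.approximateUnit A) (𝓝 0) := by
      refine hsq _ (squeeze_zero (fun _ => sq_nonneg _) (fun e => hJb φ _ _) ?_)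
      simpa using ((hre φ).const_mul (4 * C ^ 2)).mul_const
        (extend φ (star (c : 𝓜(ℂ, A)) * z * c)).re
    have h2 := tendsto_multExt_mul_approximateUnit_mul φ 1 (y * c)
    simp only [one_mul, ← extend_apply] at h2
    refine tendsto_nhds_unique h2 ?_
    rw [← sub_zero (∫ t, extend φ ((b t : 𝓜(ℂ, A)) * c) ∂μ)]
    refine (tendsto_const_nhds.sub h1).congr' ?_
    filter_upwards [eventually_star_eq (A := A)] with e he
    have h3 := hyd φ e c
    have h4 := hJi φ 1 c
    have h5 := hJi φ (e : 𝓜(ℂ, A)) c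
    simp only [he, star_one, one_mul, mul_assoc] at h3 h4 h5
    simp only [star_sub, star_one, he, sub_mul, one_mul, map_sub, mul_assoc]
    rw [integral_sub h4 h5, h3]
    ring
  refine ⟨y, hasFieldIntegral_iff.2 fun φ => ?_⟩
  simp only [← coe_conjElem]
  refine ⟨by simpa using hJi φ 1 1, ?_⟩
  have h1 : Tendsto (fun e : A => ∫ t, extend φ (star (1 : 𝓜(ℂ, A)) * (b t : 𝓜(ℂ, A)) * (1 - e))
      ∂μ) (CStarAlgebra.approximateUnit A) (𝓝 0) := by
    refine hsq _ (squeeze_zero (fun _ => sq_nonneg _) (fun e => hJb φ _ _) ?_)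
    simpa using (hre φ).const_mul
      (4 * C ^ 2 * (extend φ (star (1 : 𝓜(ℂ, A)) * z * 1)).re)
  have h2 := tendsto_multExt_mul_approximateUnit_mul φ y 1
  simp only [mul_one, ← extend_apply, hy1] at h2
  refine tendsto_nhds_unique h2 ?_
  rw [← sub_zero (∫ t, extend φ ((conjElem (a t) (x t) : A) : 𝓜(ℂ, A)) ∂μ)]
  refine (tendsto_const_nhds.sub h1).congr' (Eventually.of_forall fun e => ?_)
  have h4 := hJi φ 1 1
  have h5 := hJi φ 1 e
  simp only [star_one, one_mul, mul_one] at h4 h5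
  simp only [star_one, one_mul, mul_sub, mul_one, map_sub]
  rw [integral_sub h4 h5]
  ring

end Existence

/-! ### The joint spectral calculus -/

section JointCalculus

variable {B : Type*} [CStarAlgebra B] {n : ℕ} {y : Fin n → B}

instance (y : Fin n → B) : CompactSpace (jointBox y) :=
  isCompact_iff_compactSpace.1 (isCompact_univ_pi fun i => spectrum.isCompact (𝕜 := ℝ) (y i))

/-- Stone–Weierstrass on the product of the spectra. -/
theorem subalgebra_eq_top_of_coordinate_mem (S : Subalgebra ℝ C(jointBox y, ℝ))
    (hS : IsClosed (S : Set C(jointBox y, ℝ))) (hy : ∀ i, coordinate y i ∈ S) : S = ⊤ := by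
  have h1 : S.topologicalClosure = ⊤ := by
    refine ContinuousMap.subalgebra_topologicalClosure_eq_top_of_separatesPoints S ?_
    intro s t hst
    obtain ⟨i, hi⟩ : ∃ i, s.1 i ≠ t.1 i := by
      by_contra! h
      exact hst (Subtype.ext (funext h))
    exact ⟨_, ⟨coordinate y i, hy i, rfl⟩, hi⟩
  rw [← h1]
  exact le_antisymm S.le_topologicalClosure (S.topologicalClosure_minimal le_rfl hS)

theorem IsSpectralCalculus.unique {Ψ Ψ' : C(jointBox y, ℝ) →⋆ₐ[ℝ] B}
    (h : IsSpectralCalculus y Ψ) (h' : IsSpectralCalculus y Ψ') : Ψ = Ψ' := by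
  have h1 : AlgHom.equalizer Ψ.toAlgHom Ψ'.toAlgHom = ⊤ :=
    subalgebra_eq_top_of_coordinate_mem _ (isClosed_eq h.1 h'.1) fun i =>
      (h.2 i).trans (h'.2 i).symm
  ext g
  have : g ∈ AlgHom.equalizer Ψ.toAlgHom Ψ'.toAlgHom := h1 ▸ Algebra.mem_top
  exact this

theorem IsSpectralCalculus.jointCfc_eq {Ψ : C(jointBox y, ℝ) →⋆ₐ[ℝ] B}
    (h : IsSpectralCalculus y Ψ) {f : (Fin n → ℝ) → ℝ} (hf : ContinuousOn f (jointBox y)) :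
    jointCfc f y = Ψ ⟨(jointBox y).domRestrict f, hf.domRestrict⟩ := by
  have h1 : (∃ Ψ, IsSpectralCalculus y Ψ) ∧ ContinuousOn f (jointBox y) := ⟨⟨Ψ, h⟩, hf⟩
  rw [jointCfc, dif_pos h1, h1.1.choose_spec.unique h]

/-- Existence of the spectral calculus, from Gelfand's theorem. -/
theorem exists_isSpectralCalculus (hsa : ∀ i, IsSelfAdjoint (y i))
    (hcomm : ∀ i j, Commute (y i) (y j)) : ∃ Ψ, IsSpectralCalculus y Ψ := by
  have hc : IsMulCommutative (StarAlgebra.adjoin ℂ (Set.range y)) := by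
    refine StarAlgebra.isMulCommutative_adjoin ℂ ?_ ?_
    · rintro _ ⟨i, rfl⟩ _ ⟨j, rfl⟩
      exact hcomm i j
    · rintro _ ⟨i, rfl⟩ _ ⟨j, rfl⟩
      rw [(hsa j).star_eq]
      exact hcomm i j
  let D := (StarAlgebra.adjoin ℂ (Set.range y)).topologicalClosure
  have hD : IsClosed (D : Set B) := StarSubalgebra.isClosed_topologicalClosure _
  have hmul : ∀ u v : D, u * v = v * u :=
    (StarSubalgebra.commRingTopologicalClosure _ fun u v => mul_comm' u v).mul_comm
  let _ : CommCStarAlgebra D := { (inferInstance : CStarAlgebra D) with mul_comm := hmul }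
  let η : Fin n → D := fun i => ⟨y i, StarSubalgebra.le_topologicalClosure _
    (StarAlgebra.subset_adjoin ℂ _ ⟨i, rfl⟩)⟩
  have hη : ∀ i, IsSelfAdjoint (η i) := fun i => Subtype.ext (hsa i).star_eq
  have hre : ∀ (χ : WeakDual.characterSpace ℂ D) i, (((χ (η i)).re : ℝ) : ℂ) = χ (η i) := by
    intro χ i
    have h1 := map_star χ (η i)
    rw [(hη i).star_eq] at h1
    exact (Complex.conj_eq_iff_re.1 h1.symm)
  let q : C(WeakDual.characterSpace ℂ D, jointBox y) :=
    ⟨fun χ => ⟨fun i => (χ (η i)).re, fun i _ => by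
        have h1 := WeakDual.CharacterSpace.apply_mem_spectrum χ (η i)
        rw [StarSubalgebra.spectrum_eq (hS := hD), ← hre] at h1
        exact (spectrum.algebraMap_mem_iff ℂ).1 h1⟩,
      Continuous.subtype_mk (continuous_pi fun i => Complex.continuous_re.comp
        ((WeakDual.eval_continuous (η i)).comp continuous_subtype_val)) _⟩
  let Ψ₁ := ContinuousMap.compStarAlgHom' ℝ ℝ q
  let Ψ₂ := ContinuousMap.compStarAlgHom (WeakDual.characterSpace ℂ D) (StarAlgHom.ofId ℝ ℂ)
    Complex.continuous_ofReal
  let Ψ₃ := ((gelfandStarTransform D).symm : C(WeakDual.characterSpace ℂ D, ℂ) →⋆ₐ[ℂ] D)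
  let Ψ₄ := (D.subtype.comp Ψ₃).restrictScalars ℝ
  refine ⟨Ψ₄.comp (Ψ₂.comp Ψ₁), ?_, fun i => ?_⟩
  · have h4 : Continuous Ψ₄ :=
      continuous_subtype_val.comp (StarAlgEquiv.isometry (gelfandStarTransform D).symm).continuous
    have h2 : Continuous Ψ₂ := ContinuousMap.continuous_postcomp
      ⟨fun r : ℝ => (r : ℂ), Complex.continuous_ofReal⟩
    have h1 : Continuous Ψ₁ := ContinuousMap.continuous_precomp q
    exact h4.comp (h2.comp h1)
  · have h1 : Ψ₂ (Ψ₁ (coordinate y i)) = gelfandStarTransform D (η i) := by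
      ext χ
      exact hre χ i
    change ((gelfandStarTransform D).symm (Ψ₂ (Ψ₁ (coordinate y i))) : B) = y i
    rw [h1, StarAlgEquiv.symm_apply_apply]

theorem single_mem_jointBox {x : B} (i : Fin n) {s : ℝ} (hs : s ∈ spectrum ℝ x) :
    (Pi.single i s : Fin n → ℝ) ∈ jointBox (Pi.single i x : Fin n → B) := by
  have : Nontrivial B := by
    by_contra h
    rw [not_nontrivial_iff_subsingleton] at h
    simp at hs
  intro j _
  by_cases hj : j = i
  · subst hj; simpa using hs
  · simp [Pi.single_eq_of_ne hj]

/-- On a tuple with one nonzero entry the joint calculus is that of this entry; the others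
have spectrum `{0}`. -/
theorem jointCfc_single {x : B} (hx : IsSelfAdjoint x) (i : Fin n) {f : (Fin n → ℝ) → ℝ}
    (hf : ContinuousOn f (jointBox (Pi.single i x : Fin n → B))) :
    jointCfc f (Pi.single i x : Fin n → B) = cfc (fun s => f (Pi.single i s)) x := by
  have hcont : Continuous fun s : ℝ => (Pi.single i s : Fin n → ℝ) :=
    continuous_single (A := fun _ => ℝ) i
  let q : C(spectrum ℝ x, jointBox (Pi.single i x : Fin n → B)) :=
    ⟨fun s => ⟨Pi.single i s.1, single_mem_jointBox i s.2⟩,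
      (hcont.comp continuous_subtype_val).subtype_mk _⟩
  let Ψ := (cfcHom (R := ℝ) hx).comp (ContinuousMap.compStarAlgHom' ℝ ℝ q)
  have hΨ : IsSpectralCalculus (Pi.single i x : Fin n → B) Ψ := by
    refine ⟨(cfcHom_continuous hx).comp (ContinuousMap.continuous_precomp q), fun j => ?_⟩
    by_cases hj : j = i
    · subst hj
      have h1 : (coordinate (Pi.single j x : Fin n → B) j).comp q =
          ContinuousMap.restrict (spectrum ℝ x) (ContinuousMap.id ℝ) := by
        ext s
        exact Pi.single_eq_same (M := fun _ => ℝ) j s.1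
      change cfcHom hx ((coordinate (Pi.single j x : Fin n → B) j).comp q) = _
      rw [h1, cfcHom_id, Pi.single_eq_same]
    · have h1 : (coordinate (Pi.single i x : Fin n → B) j).comp q = 0 := by
        ext s
        exact Pi.single_eq_of_ne (M := fun _ => ℝ) hj s.1
      change cfcHom hx ((coordinate (Pi.single i x : Fin n → B) j).comp q) = _
      rw [h1, map_zero, Pi.single_eq_of_ne hj]
  have hf' : ContinuousOn (fun s => f (Pi.single i s)) (spectrum ℝ x) :=
    hf.comp hcont.continuousOn fun s hs => single_mem_jointBox i hs
  rw [hΨ.jointCfc_eq hf, cfc_apply _ x hx hf']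
  rfl

end JointCalculus

/-! ### The spectrum of an integral of compressions -/

section Spectrum

variable {A : Type*} [NonUnitalCStarAlgebra A]

theorem spectrum_coe_subset (x : A) : spectrum ℝ (x : 𝓜(ℂ, A)) ⊆ quasispectrum ℝ x :=
  (spectrum_subset_quasispectrum ℝ _).trans
    (NonUnitalAlgHom.quasispectrum_apply_subset' ℂ (DoubleCentralizer.coeHom (𝕜 := ℂ) (A := A)) x)

theorem star_mul_algebraMap_mul (a : 𝓜(ℂ, A)) (r : ℝ) :
    star a * algebraMap ℝ 𝓜(ℂ, A) r * a = r • (star a * a) := by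
  rw [Algebra.algebraMap_eq_smul_one, mul_smul_comm, mul_one, smul_mul_assoc]

variable [PartialOrder A] [StarOrderedRing A]

theorem norm_apply_le_of_extend_one (φ : A →ₚ[ℂ] ℂ) (h : extend φ 1 = 1) (d : A) :
    ‖φ d‖ ≤ ‖d‖ := by
  have h1 := norm_apply_star_mul_sq_le (extend φ) 1 (d : 𝓜(ℂ, A))
  rw [star_one, one_mul, one_mul, h, norm_one, one_mul, extend_coe] at h1
  have h2 := re_mono (extend φ) (CStarAlgebra.star_mul_le_algebraMap_norm_sq
    (a := (d : 𝓜(ℂ, A))))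
  rw [Algebra.algebraMap_eq_smul_one, PositiveLinearMap.map_smul_of_tower, h,
    ← norm_eq_re _ (star_mul_self_nonneg _), norm_coe', Complex.smul_re, smul_eq_mul,
    Complex.one_re, mul_one] at h2
  exact le_of_sq_le_sq (h1.trans h2) (norm_nonneg _)

theorem extend_smul_one_conj (φ : A →ₚ[ℂ] ℂ) (r : ℝ) (m : 𝓜(ℂ, A)) :
    extend (conjFunctional φ (r • 1)) m = (r ^ 2 : ℝ) * extend φ m := by
  rw [extend_conjFunctional, star_smul, star_trivial, star_one, smul_mul_assoc, one_mul,
    mul_smul_comm, mul_one, smul_smul, PositiveLinearMap.map_smul_of_tower, ← sq, Complex.real_smul]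

/-- A positive point `s` of the spectrum of a self-adjoint `u` in `A` is dominated by `φ(u)` for a
positive functional of norm at most one. This is a limit of functionals with `φ(u) ≥ s - ε` along an
ultrafilter. The limit may lose mass, and it would be useless for a multiplier `u`, as its values
are only controlled on `A`. -/
theorem exists_functional_of_mem_spectrum {u : A} (hu : IsSelfAdjoint u) {s : ℝ} (hs : 0 < s)
    (hmem : s ∈ spectrum ℝ (u : 𝓜(ℂ, A))) :
    ∃ φ : A →ₚ[ℂ] ℂ, (extend φ 1).re ≤ 1 ∧ s ≤ (φ u).re := by
  have husa : IsSelfAdjoint (u : 𝓜(ℂ, A)) := isSelfAdjoint_coe hu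
  have key : ∀ r < s, 0 ≤ r → ∃ φ : A →ₚ[ℂ] ℂ, extend φ 1 = 1 ∧ r ≤ (φ u).re := by
    intro r hr hr0
    have h1 : ¬ ((u : 𝓜(ℂ, A)) ≤ algebraMap ℝ _ r) := fun h =>
      hr.not_ge ((le_algebraMap_iff_spectrum_le husa).1 h s hmem)
    obtain ⟨φ, hφ⟩ : ∃ φ : A →ₚ[ℂ] ℂ,
        ¬ (extend φ (u : 𝓜(ℂ, A)) ≤ extend φ (algebraMap ℝ _ r)) := by
      by_contra! h
      exact h1 (multiplier_le_of_forall h)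
    have h1pos : (0 : 𝓜(ℂ, A)) ≤ 1 := zero_le_one' _
    have himu : (φ u).im = 0 := Complex.conj_eq_iff_im.1 (by
      rw [← RCLike.star_def, ← map_star, hu.star_eq])
    have hp := re_nonneg (extend φ) h1pos
    have hre : r * (extend φ 1).re < (φ u).re := by
      by_contra! h
      refine hφ ?_
      rw [Algebra.algebraMap_eq_smul_one, PositiveLinearMap.map_smul_of_tower, extend_coe,
        ← ofReal_re_eq (extend φ) h1pos, Complex.real_smul, ← Complex.ofReal_mul]
      exact ⟨by simpa using h, by simpa using himu⟩
    have hle : (φ u).re ≤ ‖u‖ * (extend φ 1).re := by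
      have := re_mono (extend φ) (IsSelfAdjoint.le_algebraMap_norm_self husa)
      rwa [Algebra.algebraMap_eq_smul_one, PositiveLinearMap.map_smul_of_tower, extend_coe,
        norm_coe', Complex.smul_re, smul_eq_mul] at this
    set p := (extend φ 1).re with hpdef
    have hp0 : 0 < p := by
      refine hp.lt_of_ne fun h => ?_
      rw [← h, mul_zero] at hre hle
      exact absurd hre hle.not_gt
    have hsq : (√p)⁻¹ ^ 2 = p⁻¹ := by rw [inv_pow, Real.sq_sqrt hp]
    refine ⟨conjFunctional φ ((√p)⁻¹ • 1), ?_, ?_⟩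
    · rw [extend_smul_one_conj, hsq, ← ofReal_re_eq (extend φ) h1pos, ← hpdef,
        ← Complex.ofReal_mul, inv_mul_cancel₀ hp0.ne', Complex.ofReal_one]
    · rw [← extend_coe, extend_smul_one_conj, hsq, extend_coe, Complex.re_ofReal_mul,
        inv_mul_eq_div, le_div_iff₀ hp0]
      exact hre.le
  have hr : ∀ n : ℕ, s - s / (n + 1) < s ∧ 0 ≤ s - s / (n + 1) := fun n => by
    refine ⟨sub_lt_self _ (by positivity), sub_nonneg.2 (div_le_self hs.le ?_)⟩
    have : (0 : ℝ) ≤ n := n.cast_nonneg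
    linarith
  choose φ hφ1 hφu using fun n : ℕ => key _ (hr n).1 (hr n).2
  have hU : ((hyperfilter ℕ : Ultrafilter ℕ) : Filter ℕ) ≤ atTop :=
    Nat.hyperfilter_le_atTop
  set U : Ultrafilter ℕ := hyperfilter ℕ
  have hlim : ∀ d : A, ∃ w : ℂ, ‖w‖ ≤ ‖d‖ ∧ Tendsto (fun n => φ n d) U (𝓝 w) := fun d => by
    obtain ⟨w, hw, h⟩ := (isCompact_closedBall (0 : ℂ) ‖d‖).ultrafilter_le_nhds'
      (U.map fun n => φ n d) (by
        change ∀ᶠ n in (U : Filter ℕ), φ n d ∈ Metric.closedBall 0 ‖d‖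
        exact Eventually.of_forall fun n => by
          simpa using norm_apply_le_of_extend_one (φ n) (hφ1 n) d)
    exact ⟨w, by simpa using hw, h⟩
  choose L hLn hL using hlim
  let Φ : A →ₚ[ℂ] ℂ := PositiveLinearMap.mk₀
    { toFun := L
      map_add' := fun c d => tendsto_nhds_unique (hL (c + d)) <| by
        simpa only [map_add] using (hL c).add (hL d)
      map_smul' := fun r d => tendsto_nhds_unique (hL (r • d)) <| by
        simpa only [map_smul, RingHom.id_apply] using (hL d).const_smul r }
    fun d hd => ge_of_tendsto' (hL d) fun n => (φ n).map_nonneg hd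
  have hΦ : ∀ d, Φ d = L d := fun d => rfl
  refine ⟨Φ, ?_, ?_⟩
  · refine (Complex.re_le_norm _).trans ?_
    refine le_of_tendsto (tendsto_multExt Φ 1).norm ?_
    filter_upwards [(CStarAlgebra.increasingApproximateUnit A).eventually_norm] with e he
    exact (hLn e).trans he
  · rw [hΦ]
    have h1 : Tendsto (fun n => (φ n u).re) U (𝓝 (L u).re) :=
      (Complex.continuous_re.tendsto _).comp (hL u)
    have h2 : Tendsto (fun n : ℕ => s - s / (n + 1 : ℝ)) U (𝓝 s) := by
      have h3 : Tendsto (fun n : ℕ => s - s / (n + 1 : ℝ)) atTop (𝓝 (s - 0)) :=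
        tendsto_const_nhds.sub (tendsto_const_div_atTop_nhds_zero_nat s |>.comp
          (tendsto_add_atTop_nat 1) |>.congr fun n => by simp)
      rw [sub_zero] at h3
      exact h3.mono_left hU
    exact le_of_tendsto_of_tendsto' h2 h1 hφu

variable {T : Type*} [MeasurableSpace T] {μ : Measure T}
variable {a : T → 𝓜(ℂ, A)} {z y : 𝓜(ℂ, A)} {x : T → 𝓜(ℂ, A)}

/-- The bound `0 ≤ r` makes up for `z ≤ 1` in place of `z = 1`. -/
theorem conj_integral_le_algebraMap (hz : HasFieldIntegral μ (fun t => star (a t) * a t) z)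
    (hz1 : z ≤ 1) (hy : HasFieldIntegral μ (fun t => star (a t) * x t * a t) y) {r : ℝ}
    (hr : 0 ≤ r) (hx : ∀ t, x t ≤ algebraMap ℝ _ r) : y ≤ algebraMap ℝ _ r := by
  have h1 : y ≤ r • z := hy.mono (hz.real_smul r) fun t => by
    rw [← star_mul_algebraMap_mul]
    exact star_left_conjugate_le_conjugate (hx t) _
  refine h1.trans ?_
  rw [Algebra.algebraMap_eq_smul_one]
  exact smul_le_smul_of_nonneg_left hz1 hr

/-- If the integral `u = ∫ a* x a` belongs to `A`, then a number strictly above each `x t`,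
not necessarily uniformly in `t`, is not in its spectrum: a functional with
`φ(u) ≥ s` would give `∫ φ(a* (s - x) a) ≤ 0`, hence `φ(a* a) = 0` and `φ(u) = 0`. -/
theorem notMem_spectrum_of_coe (hz : HasFieldIntegral μ (fun t => star (a t) * a t) z)
    (hz1 : z ≤ 1) {u : A} (hu : IsSelfAdjoint u)
    (hy : HasFieldIntegral μ (fun t => star (a t) * x t * a t) (u : 𝓜(ℂ, A))) {s : ℝ}
    (hs : 0 < s) (hx : ∀ t, ∃ r < s, x t ≤ algebraMap ℝ _ r) :
    s ∉ spectrum ℝ (u : 𝓜(ℂ, A)) := by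
  intro hmem
  obtain ⟨φ, hφ1, hφu⟩ := exists_functional_of_mem_spectrum hu hs hmem
  set p : T → ℝ := fun t => (extend φ (star (a t) * a t)).re with hp
  set q : T → ℝ := fun t => (extend φ (star (a t) * x t * a t)).re with hq
  have hpi : Integrable p μ := (hz.integrable φ).re
  have hqi : Integrable q μ := (hy.integrable φ).re
  have hpe : ∫ t, p t ∂μ = (extend φ z).re := by
    rw [hz.extend_eq]; exact integral_re (hz.integrable φ)
  have hqe : ∫ t, q t ∂μ = (φ u).re := by
    rw [← extend_coe, hy.extend_eq]; exact integral_re (hy.integrable φ)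
  have hp0 : ∀ t, 0 ≤ p t := fun t => re_nonneg _ (star_mul_self_nonneg _)
  have hqr : ∀ t, ∃ r < s, q t ≤ r * p t := fun t => by
    obtain ⟨r, hr, h⟩ := hx t
    refine ⟨r, hr, ?_⟩
    have h1 := re_mono (extend φ) (star_left_conjugate_le_conjugate h (a t))
    rwa [star_mul_algebraMap_mul, PositiveLinearMap.map_smul_of_tower, Complex.smul_re,
      smul_eq_mul] at h1
  have hD0 : ∀ t, 0 ≤ s * p t - q t := fun t => by
    obtain ⟨r, hr, h⟩ := hqr t
    nlinarith [hp0 t]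
  have hDi : Integrable (fun t => s * p t - q t) μ := (hpi.const_mul s).sub hqi
  have hDe : ∫ t, (s * p t - q t) ∂μ = s * (extend φ z).re - (φ u).re := by
    rw [integral_sub (hpi.const_mul s) hqi, integral_const_mul, hpe, hqe]
  have hz1' : (extend φ z).re ≤ 1 := (re_mono (extend φ) hz1).trans hφ1
  have hzero : ∫ t, (s * p t - q t) ∂μ = 0 := by
    refine le_antisymm ?_ (integral_nonneg hD0)
    rw [hDe]
    nlinarith
  have hae := (integral_eq_zero_iff_of_nonneg hD0 hDi).1 hzero
  have hpz : ∫ t, p t ∂μ = 0 := by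
    refine integral_eq_zero_of_ae ?_
    filter_upwards [hae] with t ht
    obtain ⟨r, hr, h⟩ := hqr t
    have ht' : s * p t - q t = 0 := ht
    have h0 := hp0 t
    change p t = 0
    by_contra hne
    have : 0 < p t := h0.lt_of_ne' hne
    nlinarith
  rw [hDe, ← hpe, hpz] at hzero
  linarith

/-- The integral of compressions of elements with spectra in `I` has its spectrum in `I`, where
negative and positive candidates outside `I` are excluded by symmetric arguments. If the integral
is outside `A` a uniform gap is needed, which compactness gives. -/
theorem spectrum_conj_integral_subset {x : T → A} {I : Set ℝ} (hI : I.OrdConnected)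
    (hI0 : (0 : ℝ) ∈ I) (hxsa : ∀ t, IsSelfAdjoint (x t)) (hxI : ∀ t, quasispectrum ℝ (x t) ⊆ I)
    (hz : HasFieldIntegral μ (fun t => star (a t) * a t) z) (hz1 : z ≤ 1)
    (hy : HasFieldIntegral μ (fun t => star (a t) * (x t : 𝓜(ℂ, A)) * a t) y)
    (H : (∃ u : A, y = (u : 𝓜(ℂ, A))) ∨
      ∃ K ⊆ I, IsCompact K ∧ ∀ t, quasispectrum ℝ (x t) ⊆ K) :
    spectrum ℝ y ⊆ I := by
  have hxM : ∀ t, IsSelfAdjoint (x t : 𝓜(ℂ, A)) := fun t =>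
    isSelfAdjoint_coe (hxsa t)
  have hysa : IsSelfAdjoint y := hy.isSelfAdjoint fun t => by
    simp [IsSelfAdjoint, mul_assoc, (hxM t).star_eq]
  have hy' : HasFieldIntegral μ (fun t => star (a t) * (-(x t : 𝓜(ℂ, A))) * a t) (-y) := by
    simpa using hy.neg
  intro s hs
  by_contra hsI
  rcases lt_trichotomy s 0 with hs0 | rfl | hs0
  · have hlt : ∀ q ∈ I, s < q := fun q hq => by
      by_contra! h
      exact hsI (hI.out hq hI0 ⟨h, hs0.le⟩)
    have hsneg : -s ∈ spectrum ℝ (-y) := by rw [← spectrum.neg_eq]; simpa using hs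
    rcases H with ⟨u, rfl⟩ | ⟨K, hKI, hK, hxK⟩
    · have hu : IsSelfAdjoint u := coe_injective' (by
        change ((star u : A) : 𝓜(ℂ, A)) = ((u : A) : 𝓜(ℂ, A))
        rw [coe_star']; exact hysa)
      have hneg : ((-u : A) : 𝓜(ℂ, A)) = -(u : 𝓜(ℂ, A)) := by
        simpa using coe_sub' (0 : A) u
      rw [← hneg] at hsneg hy'
      refine notMem_spectrum_of_coe hz hz1 hu.neg hy' (neg_pos.2 hs0) (fun t => ?_) hsneg
      obtain ⟨r, hr, hmin⟩ := (quasispectrum.isCompact (𝕜 := ℝ) (x t)).exists_isMinOn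
        ⟨0, quasispectrum.zero_mem ℝ _⟩ continuousOn_id
      refine ⟨-r, neg_lt_neg (hlt r (hxI t hr)), ?_⟩
      rw [map_neg, neg_le_neg_iff, algebraMap_le_iff_le_spectrum (hxM t)]
      exact fun q hq => hmin (spectrum_coe_subset _ hq)
    · obtain ⟨r, hr, hmin⟩ := (hK.insert 0).exists_isMinOn ⟨0, Set.mem_insert _ _⟩ continuousOn_id
      have hrs : s < r := hlt r (Set.insert_subset hI0 hKI hr)
      have hr0 : r ≤ 0 := hmin (Set.mem_insert _ _)
      have h1 := conj_integral_le_algebraMap hz hz1 hy' (r := -r) (by linarith) fun t => by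
        rw [map_neg, neg_le_neg_iff, algebraMap_le_iff_le_spectrum (hxM t)]
        exact fun q hq => hmin (Set.mem_insert_of_mem _ (hxK t (spectrum_coe_subset _ hq)))
      have h2 := (le_algebraMap_iff_spectrum_le hysa.neg).1 h1 _ hsneg
      linarith
  · exact hsI hI0
  · have hlt : ∀ q ∈ I, q < s := fun q hq => by
      by_contra! h
      exact hsI (hI.out hI0 hq ⟨hs0.le, h⟩)
    rcases H with ⟨u, rfl⟩ | ⟨K, hKI, hK, hxK⟩
    · have hu : IsSelfAdjoint u := coe_injective' (by
        change ((star u : A) : 𝓜(ℂ, A)) = ((u : A) : 𝓜(ℂ, A))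
        rw [coe_star']; exact hysa)
      refine notMem_spectrum_of_coe hz hz1 hu hy hs0 (fun t => ?_) hs
      obtain ⟨r, hr, hmax⟩ := (quasispectrum.isCompact (𝕜 := ℝ) (x t)).exists_isMaxOn
        ⟨0, quasispectrum.zero_mem ℝ _⟩ continuousOn_id
      refine ⟨r, hlt r (hxI t hr), ?_⟩
      rw [le_algebraMap_iff_spectrum_le (hxM t)]
      exact fun q hq => hmax (spectrum_coe_subset _ hq)
    · obtain ⟨r, hr, hmax⟩ := (hK.insert 0).exists_isMaxOn ⟨0, Set.mem_insert _ _⟩ continuousOn_id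
      have hrs : r < s := hlt r (Set.insert_subset hI0 hKI hr)
      have hr0 : 0 ≤ r := hmax (Set.mem_insert _ _)
      have h1 := conj_integral_le_algebraMap hz hz1 hy hr0 fun t => by
        rw [le_algebraMap_iff_spectrum_le (hxM t)]
        exact fun q hq => hmax (Set.mem_insert_of_mem _ (hxK t (spectrum_coe_subset _ hq)))
      have h2 := (le_algebraMap_iff_spectrum_le hysa).1 h1 _ hs
      linarith

end Spectrum

/-! ### Integrability of compressions of `g(x)` -/

section RightHandSide

variable {A : Type*} [NonUnitalCStarAlgebra A]

theorem single_mem_univ_pi {n : ℕ} {I : Fin n → Set ℝ} (hI0 : ∀ i, (0 : ℝ) ∈ I i) (i : Fin n)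
    {s : ℝ} (hs : s ∈ I i) : (Pi.single i s : Fin n → ℝ) ∈ Set.pi Set.univ I := by
  intro j _
  by_cases hj : j = i
  · subst hj; simpa using hs
  · simpa [Pi.single_eq_of_ne hj] using hI0 j

theorem jointBox_single_subset {B : Type*} [CStarAlgebra B] {n : ℕ} {I : Fin n → Set ℝ}
    (hI0 : ∀ i, (0 : ℝ) ∈ I i) (i : Fin n)
    {x : B} (hx : spectrum ℝ x ⊆ I i) :
    jointBox (Pi.single i x : Fin n → B) ⊆ Set.pi Set.univ I := by
  intro s hs j _
  have h1 := hs j trivial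
  by_cases hj : j = i
  · subst hj; exact hx (by simpa using h1)
  · simp only [Pi.single_eq_of_ne hj] at h1
    have : Nontrivial B := by
      by_contra h
      rw [not_nontrivial_iff_subsingleton] at h
      simp at h1
    rw [spectrum.zero_eq, Set.mem_singleton_iff] at h1
    exact h1 ▸ hI0 j

theorem jointCfc_single_coe {n : ℕ} {I : Fin n → Set ℝ} (hI0 : ∀ i, (0 : ℝ) ∈ I i)
    {f : (Fin n → ℝ) → ℝ} (hf : ContinuousOn f (Set.pi Set.univ I)) (i : Fin n) {x : A}
    (hx : IsSelfAdjoint x) (hxI : quasispectrum ℝ x ⊆ I i) :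
    jointCfc f (Pi.single i (x : 𝓜(ℂ, A)) : Fin n → 𝓜(ℂ, A)) =
      cfc (fun s => f (Pi.single i s)) (x : 𝓜(ℂ, A)) :=
  jointCfc_single (isSelfAdjoint_coe hx) i <| hf.mono <|
    jointBox_single_subset hI0 i ((spectrum_coe_subset x).trans hxI)

theorem coe_cfcₙ {G : ℝ → ℝ} (hG : Continuous G) (hG0 : G 0 = 0) {x : A} (hx : IsSelfAdjoint x) :
    ((cfcₙ G x : A) : 𝓜(ℂ, A)) = cfc G (x : 𝓜(ℂ, A)) := by
  have hx' : IsSelfAdjoint (x : 𝓜(ℂ, A)) := isSelfAdjoint_coe hx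
  have hc : Continuous (DoubleCentralizer.coeHom (𝕜 := ℂ) (A := A)) :=
    AddMonoidHomClass.isometry_of_norm _ (fun a => norm_coe' a) |>.continuous
  rw [← cfcₙ_eq_cfc hG.continuousOn hG0]
  exact (DoubleCentralizer.coeHom (𝕜 := ℂ) (A := A)).map_cfcₙ G x hG.continuousOn hG0 hc hx hx'

variable [PartialOrder A] [StarOrderedRing A] [TopologicalSpace.SeparableSpace A]
variable {T : Type*} [MeasurableSpace T] {μ : Measure T}
variable {a : T → 𝓜(ℂ, A)} {z y : 𝓜(ℂ, A)} {x : T → A}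

/-- A compression of `g(x)` is integrable if the spectra of the `x t` stay in one compact set on
which `g` is continuous. Since `g(x)` is not in `A` in general, write it as the constant `g 0` and
`G(x)`, where `G` extends `g - g 0` continuously to the line; the map `b ↦ G(Re b)` is then
continuous on all of `A`, so `G(x)` is a measurable field. -/
theorem fieldIntegrable_conj_cfc (ha : WeakStarMeasurable μ a)
    (hz : HasFieldIntegral μ (fun t => star (a t) * a t) z) (hxm : AEStronglyMeasurable x μ)
    (hxsa : ∀ t, IsSelfAdjoint (x t)) {K : Set ℝ} (hK : IsCompact K) (hK0 : (0 : ℝ) ∈ K)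
    (hxK : ∀ t, quasispectrum ℝ (x t) ⊆ K) {g : ℝ → ℝ} (hg : ContinuousOn g K) :
    FieldIntegrable μ fun t => star (a t) * cfc g (x t : 𝓜(ℂ, A)) * a t := by
  obtain ⟨G, hG⟩ := ContinuousMap.exists_restrict_eq hK.isClosed
    ⟨fun s : K => g s - g 0, hg.domRestrict.sub continuous_const⟩
  have hGK : ∀ s ∈ K, G s = g s - g 0 := fun s hs => DFunLike.congr_fun hG ⟨s, hs⟩
  have hG0 : G 0 = 0 := by rw [hGK 0 hK0, sub_self]
  have hcfc : ∀ t, cfc g (x t : 𝓜(ℂ, A)) = g 0 • 1 + ((cfcₙ G (x t) : A) : 𝓜(ℂ, A)) := by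
    intro t
    have hsp : spectrum ℝ (x t : 𝓜(ℂ, A)) ⊆ K := (spectrum_coe_subset _).trans (hxK t)
    rw [coe_cfcₙ G.continuous hG0 (hxsa t), ← Algebra.algebraMap_eq_smul_one, ← cfc_const_add _ _ _
      G.continuous.continuousOn (isSelfAdjoint_coe (hxsa t))]
    exact cfc_congr fun s hs => by simp [hGK s (hsp hs)]
  have hcont : Continuous fun b : A => cfcₙ G ((realPart b : selfAdjoint A) : A) :=
    Continuous.cfcₙ_of_mem_nhdsSet (s := Set.univ) G univ_mem (by fun_prop)
      (fun b => (realPart b).2) G.continuous.continuousOn hG0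
  have hm : AEStronglyMeasurable (fun t => cfcₙ G (x t)) μ := by
    have h1 := hcont.comp_aestronglyMeasurable hxm
    simpa only [(hxsa _).coe_realPart] using h1
  obtain ⟨C, hC⟩ := hK.exists_bound_of_continuousOn G.continuous.continuousOn
  obtain ⟨w, hw⟩ := exists_hasFieldIntegral_conj ha hz hm
    (fun t => cfcₙ_predicate _ _) (fun t => norm_cfcₙ_le fun s hs => hC s (hxK t hs))
    ((norm_nonneg _).trans (hC 0 hK0))
  have hsum := ((hz.real_smul (g 0)).add hw).fieldIntegrable
  simpa only [hcfc, mul_add, add_mul, mul_smul_comm, smul_mul_assoc, mul_one] using hsum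

end RightHandSide

/-! ### Affine minorants of convex functions -/

section AffineMinorants

/-- A convex function which is continuous on its domain is, up to any `ε`, the supremum of its
affine minorants, also at boundary points of the domain. The minorant comes from a hyperplane which
separates `(l, f l - ε)` from the epigraph. -/
theorem exists_affine_minorant {n : ℕ} {D : Set (Fin n → ℝ)} {f : (Fin n → ℝ) → ℝ}
    (hconv : ConvexOn ℝ D f) (hcont : ContinuousOn f D) {l : Fin n → ℝ} (hl : l ∈ D)
    {ε : ℝ} (hε : 0 < ε) :
    ∃ (α : ℝ) (g : Fin n → ℝ), (∀ s ∈ D, α + ∑ i, g i * s i ≤ f s) ∧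
      α + ∑ i, g i * l i = f l - ε := by
  let E : Set ((Fin n → ℝ) × ℝ) := {p | p.1 ∈ D ∧ f p.1 ≤ p.2}
  have hnot : (l, f l - ε) ∉ closure E := by
    intro hmem
    have h1 : ∀ᶠ s in 𝓝 l, s ∈ D → f l - ε / 2 < f s :=
      eventually_nhdsWithin_iff.1 ((hcont l hl).eventually_const_lt (by linarith))
    have h2 : ∀ᶠ r in 𝓝 (f l - ε), r < f l - ε / 2 := eventually_lt_nhds (by linarith)
    obtain ⟨p, hpE, hp⟩ := ((mem_closure_iff_frequently.1 hmem).and_eventually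
      (h1.prod_nhds h2)).exists
    linarith [hp.1 hpE.1, hp.2, hpE.2]
  obtain ⟨L, u, hLu, hL⟩ := geometric_hahn_banach_point_closed
    hconv.convex_epigraph.closure isClosed_closure hnot
  have hsplit : ∀ (s : Fin n → ℝ) (r : ℝ),
      L (s, r) = ∑ i, s i * L (Pi.single i 1, 0) + r * L (0, 1) := by
    intro s r
    have h1 : (s, r) = ∑ i, s i • ((Pi.single i 1, 0) : (Fin n → ℝ) × ℝ) + r • (0, 1) := by
      ext j
      · simp [Prod.fst_sum, Finset.sum_apply, Pi.single_apply]
      · simp [Prod.snd_sum]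
    rw [h1, map_add, map_sum, map_smul, smul_eq_mul]
    simp only [map_smul, smul_eq_mul]
  have hlt : ∀ s ∈ D, L (l, f l - ε) < L (s, f s) := fun s hs =>
    hLu.trans (hL _ (subset_closure ⟨hs, le_rfl⟩))
  -- the separating hyperplane is not vertical, since it separates two points over `l`
  have hc : 0 < L (0, 1) := by
    have h1 := hlt l hl
    rw [hsplit l, hsplit _ (f _)] at h1
    by_contra! h
    nlinarith
  refine ⟨f l - ε + (∑ i, l i * L (Pi.single i 1, 0)) / L (0, 1),
    fun i => - (L (Pi.single i 1, 0) / L (0, 1)), fun s hs => ?_, ?_⟩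
  · have h1 := hlt s hs
    rw [hsplit l, hsplit _ (f _)] at h1
    have h2 : ∑ i, -(L (Pi.single i 1, 0) / L (0, 1)) * s i =
        - (∑ i, s i * L (Pi.single i 1, 0)) / L (0, 1) := by
      rw [← Finset.sum_neg_distrib, Finset.sum_div]
      exact Finset.sum_congr rfl fun i _ => by ring
    rw [h2, add_assoc, ← add_div, ← sub_eq_add_neg, ← le_sub_iff_add_le', div_le_iff₀ hc]
    linarith
  · have h2 : ∑ i, -(L (Pi.single i 1, 0) / L (0, 1)) * l i =
        - ((∑ i, l i * L (Pi.single i 1, 0)) / L (0, 1)) := by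
      rw [Finset.sum_div, ← Finset.sum_neg_distrib]
      exact Finset.sum_congr rfl fun i _ => by ring
    rw [h2]
    ring

end AffineMinorants

/-! ### Gluing minorants along elements of the centralizer -/

section Trace

variable {B : Type*} [CStarAlgebra B] [PartialOrder B] [StarOrderedRing B]
variable {X : Type*} [TopologicalSpace X]

theorem map_nonneg_of_continuousMap (Ψ : C(X, ℝ) →⋆ₐ[ℝ] B) {g : C(X, ℝ)} (hg : ∀ s, 0 ≤ g s) :
    0 ≤ Ψ g := by
  let w : C(X, ℝ) := ⟨fun s => √(g s), by fun_prop⟩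
  have h1 : g = star w * w := by
    ext s
    exact (Real.mul_self_sqrt (hg s)).symm
  rw [h1, map_mul, map_star]
  exact star_mul_self_nonneg _

variable [CompactSpace X]

/-- Let the range of `Ψ` be in the centralizer of `τ`. If `R` dominates `Ψ h` for functions `h`
which come arbitrarily close to `f`, or exceed it, at each given point, then `R`
satisfies `τ(Ψ f) ≤ τ(R)`. Compactness leaves finitely many minorants `h k`; they are glued by a
partition of unity `ρ k = w k ^ 2`, as `τ(R) = ∑ τ(Ψ(w k) R Ψ(w k)) ≥ ∑ τ(Ψ(h k ρ k))`. The
centralizer condition is used for the first equality. -/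
theorem apply_le_of_local_minorants [T2Space X] (τ : B →ₚ[ℂ] ℂ) (Ψ : C(X, ℝ) →⋆ₐ[ℝ] B)
    (hτ : ∀ g m, τ (m * Ψ g) = τ (Ψ g * m)) {R : B} {f : C(X, ℝ)}
    (H : ∀ l, ∀ ε > 0, ∃ h : C(X, ℝ), f l - ε < h l ∧ Ψ h ≤ R) : τ (Ψ f) ≤ τ R := by
  have key : ∀ ε : ℝ, 0 < ε → 0 ≤ τ R - τ (Ψ f) + ε * τ 1 := by
    intro ε hε
    choose h hh hR using fun l => H l ε hε
    let U : X → Set X := fun l => {s | f s - ε < h l s}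
    have hU : ∀ l, IsOpen (U l) := fun l => isOpen_lt (by fun_prop) (by fun_prop)
    obtain ⟨t, ht⟩ := isCompact_univ.elim_finite_subcover U hU
      fun s _ => Set.mem_iUnion.2 ⟨s, hh s⟩
    obtain ⟨ρ, hρ⟩ := PartitionOfUnity.exists_isSubordinate_of_locallyFinite
      (s := Set.univ) isClosed_univ (fun l : t => U l) (fun l => hU l) (locallyFinite_of_finite _)
      (by simpa [Set.iUnion_subtype] using ht)
    have hsum : ∀ s, ∑ k, ρ k s = 1 := fun s => by
      rw [← finsum_eq_sum_of_fintype]; exact ρ.sum_eq_one (Set.mem_univ s)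
    let w : t → C(X, ℝ) := fun k => ⟨fun s => √(ρ k s), by fun_prop⟩
    have hw : ∀ k, w k * w k = ρ k := fun k => by
      ext s
      exact Real.mul_self_sqrt (ρ.nonneg k s)
    have hwsa : ∀ k, star (Ψ (w k)) = Ψ (w k) := fun k => by rw [← map_star, star_trivial]
    have h1 : ∀ k, 0 ≤ τ (R * Ψ (ρ k)) - τ (Ψ (h k * ρ k)) := by
      intro k
      have h2 : 0 ≤ τ (star (Ψ (w k)) * (R - Ψ (h k)) * Ψ (w k)) :=
        τ.map_nonneg (star_left_conjugate_nonneg (sub_nonneg.2 (hR k)) _)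
      rwa [hwsa, hτ, ← mul_assoc, ← map_mul, hw, ← hτ, sub_mul, map_sub, ← map_mul] at h2
    have h2 := Finset.sum_nonneg fun k (_ : k ∈ Finset.univ) => h1 k
    have h3 : ∑ k, ρ k = (1 : C(X, ℝ)) := by
      ext s
      simpa using hsum s
    have h4 : 0 ≤ Ψ (∑ k : t, h k * ρ k - f + ε • 1) := by
      refine map_nonneg_of_continuousMap Ψ fun s => ?_
      have h5 : ∀ k : t, (f s - ε) * ρ k s ≤ h k s * ρ k s := fun k => by
        by_cases hs : ρ k s = 0
        · simp [hs]
        · have h6 : s ∈ U k := hρ k (subset_tsupport _ hs)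
          exact mul_le_mul_of_nonneg_right (le_of_lt h6) (ρ.nonneg k s)
      have h6 := Finset.sum_le_sum fun k (_ : k ∈ Finset.univ) => h5 k
      rw [← Finset.mul_sum, hsum, mul_one] at h6
      simp only [ContinuousMap.add_apply, ContinuousMap.sub_apply, ContinuousMap.sum_apply,
        ContinuousMap.mul_apply, ContinuousMap.smul_apply, ContinuousMap.one_apply, smul_eq_mul,
        mul_one]
      linarith
    have h5 := τ.map_nonneg h4
    rw [Finset.sum_sub_distrib, ← map_sum, ← Finset.mul_sum, ← map_sum, h3, map_one, mul_one,
      ← map_sum, ← map_sum] at h2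
    rw [map_add, map_sub, map_smul, map_one, map_add, map_sub,
      PositiveLinearMap.map_smul_of_tower, Complex.real_smul] at h5
    have h6 := add_nonneg h2 h5
    convert h6 using 1
    ring
  have hlim : Tendsto (fun ε : ℝ => τ R - τ (Ψ f) + ε * τ 1) (𝓝[>] 0)
      (𝓝 (τ R - τ (Ψ f) + (0 : ℝ) * τ 1)) :=
    (Continuous.tendsto (by fun_prop) 0).mono_left nhdsWithin_le_nhds
  have h0 := ge_of_tendsto hlim (eventually_nhdsWithin_of_forall fun ε hε => key ε hε)
  simpa using h0

variable {A : Type*} [NonUnitalCStarAlgebra A] [PartialOrder A] [StarOrderedRing A]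

theorem extend_mul_comm_of_mem_centralizerOf {φ : A →ₚ[ℂ] ℂ} {y : 𝓜(ℂ, A)}
    (hy : y ∈ centralizerOf φ) (m : 𝓜(ℂ, A)) : extend φ (m * y) = extend φ (y * m) := by
  have hA : ∀ c : A, extend φ ((c : 𝓜(ℂ, A)) * y) = extend φ (y * (c : 𝓜(ℂ, A))) := fun c => by
    rw [coe_mul_multiplier, mul_coe, extend_coe, extend_coe]
    exact hy c
  have h1 := tendsto_multExt_mul_approximateUnit_mul φ m y
  have h2 := tendsto_multExt_mul_approximateUnit_mul φ (y * m) 1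
  rw [mul_one] at h2
  refine tendsto_nhds_unique_of_eventuallyEq h1 h2 (.of_forall fun e => ?_)
  have h3 := hA (m.fst e)
  rw [← mul_coe, ← mul_assoc] at h3
  simp only [mul_one]
  exact h3

/-- The centralizer of `φ` contains, with the `y i`, all elements of the calculus of `y`. -/
theorem extend_mul_comm_of_isSpectralCalculus {n : ℕ} {φ : A →ₚ[ℂ] ℂ} {y : Fin n → 𝓜(ℂ, A)}
    (hy : ∀ i, y i ∈ centralizerOf φ) {Ψ : C(jointBox y, ℝ) →⋆ₐ[ℝ] 𝓜(ℂ, A)}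
    (hΨ : IsSpectralCalculus y Ψ) (g : C(jointBox y, ℝ)) (m : 𝓜(ℂ, A)) :
    extend φ (m * Ψ g) = extend φ (Ψ g * m) := by
  let S : Subalgebra ℝ C(jointBox y, ℝ) :=
    { carrier := {g | ∀ m, extend φ (m * Ψ g) = extend φ (Ψ g * m)}
      mul_mem' := fun {g g'} hg hg' m => by
        rw [map_mul Ψ, ← mul_assoc, hg', ← mul_assoc, hg, ← mul_assoc]
      add_mem' := fun {g g'} hg hg' m => by
        rw [map_add, mul_add, add_mul, map_add, map_add, hg, hg']
      algebraMap_mem' := fun r m => by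
        rw [AlgHomClass.commutes, Algebra.commutes] }
  have hcont : Continuous (extend φ) := map_continuous _
  have hS : IsClosed (S : Set C(jointBox y, ℝ)) := by
    have : (S : Set C(jointBox y, ℝ)) =
        ⋂ m, {g | extend φ (m * Ψ g) = extend φ (Ψ g * m)} := by
      ext g; simp [S]
    rw [this]
    exact isClosed_iInter fun m => isClosed_eq
      (hcont.comp (continuous_const.mul hΨ.1)) (hcont.comp (hΨ.1.mul continuous_const))
  have htop := subalgebra_eq_top_of_coordinate_mem S hS fun i m => by
    rw [hΨ.2 i]
    exact extend_mul_comm_of_mem_centralizerOf (hy i) m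
  exact (htop ▸ Algebra.mem_top : g ∈ S) m

end Trace

/-! ### Jensen's inequality and commutation -/

section Inequality

variable {A : Type*} [NonUnitalCStarAlgebra A] [PartialOrder A] [StarOrderedRing A]
variable {T : Type*} [MeasurableSpace T] {μ : Measure T} {n : ℕ}

/-- An affine minorant of `f` evaluated at `y` is dominated by the sum of the integrals of
`a* f(0, …, x, …, 0) a`. The constant `α` is spread over the `n` terms as `∑ α • z i = α`. -/
theorem affine_le_sum_integral {I : Fin n → Set ℝ} (hI0 : ∀ i, (0 : ℝ) ∈ I i)
    {f : (Fin n → ℝ) → ℝ} (hf : ContinuousOn f (Set.pi Set.univ I)) {x : Fin n → T → A}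
    (hxsa : ∀ i t, IsSelfAdjoint (x i t)) (hxI : ∀ i t, quasispectrum ℝ (x i t) ⊆ I i)
    {a : Fin n → T → 𝓜(ℂ, A)} {z y r : Fin n → 𝓜(ℂ, A)}
    (hz : ∀ i, HasFieldIntegral μ (fun t => star (a i t) * a i t) (z i)) (hz1 : ∑ i, z i = 1)
    (hy : ∀ i, HasFieldIntegral μ (fun t => star (a i t) * (x i t : 𝓜(ℂ, A)) * a i t) (y i))
    (hr : ∀ i, HasFieldIntegral μ
      (fun t => star (a i t) * jointCfc f (Pi.single i (x i t : 𝓜(ℂ, A))) * a i t) (r i))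
    {α : ℝ} {g : Fin n → ℝ} (hg : ∀ s ∈ Set.pi Set.univ I, α + ∑ i, g i * s i ≤ f s) :
    α • 1 + ∑ i, g i • y i ≤ ∑ i, r i := by
  have h1 : ∀ i, α • z i + g i • y i ≤ r i := by
    intro i
    refine (((hz i).real_smul α).add ((hy i).real_smul (g i))).mono (hr i) fun t => ?_
    have hsa : IsSelfAdjoint (x i t : 𝓜(ℂ, A)) := isSelfAdjoint_coe (hxsa i t)
    have hsp : spectrum ℝ (x i t : 𝓜(ℂ, A)) ⊆ I i := (spectrum_coe_subset _).trans (hxI i t)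
    have hle : α • 1 + g i • (x i t : 𝓜(ℂ, A)) ≤
        jointCfc f (Pi.single i (x i t : 𝓜(ℂ, A)) : Fin n → 𝓜(ℂ, A)) := by
      have h2 : α • 1 + g i • (x i t : 𝓜(ℂ, A)) =
          cfc (fun s : ℝ => α + g i * s) (x i t : 𝓜(ℂ, A)) := by
        rw [cfc_const_add .., cfc_const_mul .., cfc_id' ℝ _ hsa, Algebra.algebraMap_eq_smul_one]
      rw [jointCfc_single_coe hI0 hf i (hxsa i t) (hxI i t), h2]
      refine cfc_mono (fun s hs => ?_) (by fun_prop) (hf.comp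
        (continuous_single (A := fun _ => ℝ) i).continuousOn
          fun s hs => single_mem_univ_pi hI0 i (hsp hs))
      have h3 := hg _ (single_mem_univ_pi hI0 i (hsp hs))
      rwa [Finset.sum_eq_single i (fun j _ hj => by simp [Pi.single_eq_of_ne hj]) (by simp),
        Pi.single_eq_same] at h3
    have h4 := star_left_conjugate_le_conjugate hle (a i t)
    simpa only [mul_add, add_mul, mul_smul_comm, smul_mul_assoc, mul_one] using h4
  have h2 := Finset.sum_le_sum fun i (_ : i ∈ Finset.univ) => h1 i
  rwa [Finset.sum_add_distrib, ← Finset.smul_sum, hz1] at h2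

/-- Jensen's inequality on the centralizer, for given values of all integrals. -/
theorem extend_jointCfc_le {I : Fin n → Set ℝ} (hI0 : ∀ i, (0 : ℝ) ∈ I i)
    {f : (Fin n → ℝ) → ℝ} (hfconv : ConvexOn ℝ (Set.pi Set.univ I) f)
    (hf : ContinuousOn f (Set.pi Set.univ I)) {x : Fin n → T → A}
    (hxsa : ∀ i t, IsSelfAdjoint (x i t)) (hxI : ∀ i t, quasispectrum ℝ (x i t) ⊆ I i)
    {a : Fin n → T → 𝓜(ℂ, A)} {z y r : Fin n → 𝓜(ℂ, A)}
    (hz : ∀ i, HasFieldIntegral μ (fun t => star (a i t) * a i t) (z i)) (hz1 : ∑ i, z i = 1)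
    (hy : ∀ i, HasFieldIntegral μ (fun t => star (a i t) * (x i t : 𝓜(ℂ, A)) * a i t) (y i))
    (hr : ∀ i, HasFieldIntegral μ
      (fun t => star (a i t) * jointCfc f (Pi.single i (x i t : 𝓜(ℂ, A))) * a i t) (r i))
    (hysa : ∀ i, IsSelfAdjoint (y i)) (hycomm : ∀ i j, Commute (y i) (y j))
    (hyI : ∀ i, spectrum ℝ (y i) ⊆ I i) {φ : A →ₚ[ℂ] ℂ} (hφ : ∀ i, y i ∈ centralizerOf φ) :
    extend φ (jointCfc f y) ≤ extend φ (∑ i, r i) := by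
  obtain ⟨Ψ, hΨ⟩ := exists_isSpectralCalculus hysa hycomm
  have hsub : jointBox y ⊆ Set.pi Set.univ I := fun s hs i hi => hyI i (hs i hi)
  rw [hΨ.jointCfc_eq (hf.mono hsub)]
  refine apply_le_of_local_minorants (extend φ) Ψ
    (extend_mul_comm_of_isSpectralCalculus hφ hΨ) fun l ε hε => ?_
  obtain ⟨α, g, hg, hgl⟩ := exists_affine_minorant hfconv hf (hsub l.2) (half_pos hε)
  refine ⟨α • 1 + ∑ i, g i • coordinate y i, ?_, ?_⟩
  · have h1 : (α • 1 + ∑ i, g i • coordinate y i) l = α + ∑ i, g i * l.1 i := by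
      simp [coordinate, ContinuousMap.sum_apply]
    rw [h1, hgl]
    change f l - ε < _
    linarith
  · have h1 : Ψ (α • 1 + ∑ i, g i • coordinate y i) = α • 1 + ∑ i, g i • y i := by
      simp only [map_add, map_sum, map_smul, map_one, hΨ.2]
    rw [h1]
    exact affine_le_sum_integral hI0 hf hxsa hxI hz hz1 hy hr hg

omit [PartialOrder A] [StarOrderedRing A] in
theorem star_mem_multipliersOf {S : NonUnitalStarSubalgebra ℂ A} {m : 𝓜(ℂ, A)}
    (hm : m ∈ multipliersOf S) : star m ∈ multipliersOf S := by
  intro c hc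
  have h1 : (star m).fst c = star (m.snd (star c)) := by simp
  have h2 : (star m).snd c = star (m.fst (star c)) := by simp
  rw [h1, h2]
  exact ⟨star_mem (hm _ (star_mem hc)).2, star_mem (hm _ (star_mem hc)).1⟩

omit [PartialOrder A] [StarOrderedRing A] in
theorem conjElem_mem {S : NonUnitalStarSubalgebra ℂ A} {m : 𝓜(ℂ, A)} {c : A}
    (hm : m ∈ multipliersOf S) (hc : c ∈ S) : conjElem m c ∈ S := by
  have h1 : ((conjElem m c : A) : 𝓜(ℂ, A)) = ((m.snd ((star m).fst c) : A) : 𝓜(ℂ, A)) := by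
    rw [coe_conjElem, ← coe_mul_multiplier, ← mul_coe]
  rw [coe_injective' h1]
  exact (hm _ ((star_mem_multipliersOf hm) c hc).1).2

/-- Integrals of compressions of fields in two commuting subalgebras commute. -/
theorem commute_conj_integral {S S' : NonUnitalStarSubalgebra ℂ A}
    (hS : ∀ c ∈ S, ∀ d ∈ S', c * d = d * c) {a a' : T → 𝓜(ℂ, A)} {x x' : T → A}
    (ha : ∀ t, a t ∈ multipliersOf S) (ha' : ∀ t, a' t ∈ multipliersOf S')
    (hx : ∀ t, x t ∈ S) (hx' : ∀ t, x' t ∈ S') {y y' : 𝓜(ℂ, A)}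
    (hy : HasFieldIntegral μ (fun t => star (a t) * (x t : 𝓜(ℂ, A)) * a t) y)
    (hy' : HasFieldIntegral μ (fun t => star (a' t) * (x' t : 𝓜(ℂ, A)) * a' t) y') :
    Commute y y' := by
  refine hy.commute fun t => (hy'.commute fun t' => ?_).symm
  rw [← coe_conjElem, ← coe_conjElem]
  change _ * _ = _ * _
  rw [← coe_mul', ← coe_mul',
    hS _ (conjElem_mem (ha t) (hx t)) _ (conjElem_mem (ha' t') (hx' t'))]

end Inequality

end JensenTrace

open JensenTrace in
theorem corollary13 {A : Type*} [NonUnitalCStarAlgebra A] [PartialOrder A] [StarOrderedRing A]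
    [TopologicalSpace.SeparableSpace A]
    {T : Type*} [MeasurableSpace T] (μ : Measure T) {n : ℕ}
    -- mutually commuting C⋆-subalgebras
    (S : Fin n → NonUnitalStarSubalgebra ℂ A)
    (hSclosed : ∀ i, IsClosed (S i : Set A))
    (hScomm : ∀ i j, i ≠ j → ∀ c ∈ S i, ∀ d ∈ S j, c * d = d * c)
    -- a convex, continuous function on a cube that contains the origin
    (I : Fin n → Set ℝ) (hI : ∀ i, (I i).OrdConnected) (hI0 : ∀ i, (0 : ℝ) ∈ I i)
    (f : (Fin n → ℝ) → ℝ)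
    (hfconv : ConvexOn ℝ (Set.pi Set.univ I) f)
    (hfcont : ContinuousOn f (Set.pi Set.univ I))
    -- bounded, weak* measurable fields of self-adjoint elements with spectra in the `I i`
    (x : Fin n → T → A)
    (hxS : ∀ i t, x i t ∈ S i)
    (hxsa : ∀ i t, IsSelfAdjoint (x i t))
    (hxI : ∀ i t, quasispectrum ℝ (x i t) ⊆ I i)
    (hxbdd : ∀ i, ∃ C : ℝ, ∀ t, ‖x i t‖ ≤ C)
    (hxmeas : ∀ i, WeakStarMeasurable μ fun t => (x i t : 𝓜(ℂ, A)))
    -- integrable column fields of multipliers, jointly unital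
    (a : Fin n → T → 𝓜(ℂ, A))
    (haS : ∀ i t, a i t ∈ multipliersOf (S i))
    (hameas : ∀ i, WeakStarMeasurable μ (a i))
    (haint : ∀ i, FieldIntegrable μ fun t => star (a i t) * a i t)
    (haone : ∑ i, fieldIntegral μ (fun t => star (a i t) * a i t) = 1) :
    let y : Fin n → 𝓜(ℂ, A) :=
      fun i => fieldIntegral μ fun t => star (a i t) * (x i t : 𝓜(ℂ, A)) * a i t
    let F : Fin n → T → 𝓜(ℂ, A) :=
      fun i t => star (a i t) * jointCfc f (Pi.single i (x i t : 𝓜(ℂ, A))) * a i t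
    -- the integrals `y i` exist and form an abelian tuple of self-adjoint elements
    (∀ i, FieldIntegrable μ fun t => star (a i t) * (x i t : 𝓜(ℂ, A)) * a i t) ∧
    (∀ i, IsSelfAdjoint (y i)) ∧
    (∀ i j, Commute (y i) (y j)) ∧
    -- the spectrum of `y i` is in `I i` if `y i` belongs to `A`, or if the spectra of the `x i t`
    -- are in a common compact subset of `I i` (so in particular if `I i` is closed)
    (∀ i, ((∃ u : A, y i = (u : 𝓜(ℂ, A))) ∨
        ∃ K ⊆ I i, IsCompact K ∧ ∀ t, quasispectrum ℝ (x i t) ⊆ K) →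
      spectrum ℝ (y i) ⊆ I i) ∧
    -- in the latter case the field on the right-hand side is integrable, too
    (∀ i, (∃ K ⊆ I i, IsCompact K ∧ ∀ t, quasispectrum ℝ (x i t) ⊆ K) →
      FieldIntegrable μ (F i)) ∧
    -- the inequality, whenever both sides of it are defined
    ((∀ i, spectrum ℝ (y i) ⊆ I i) → (∀ i, FieldIntegrable μ (F i)) →
      ∀ φ : A →ₚ[ℂ] ℂ, (∀ i, y i ∈ centralizerOf φ) →
        multExt φ (jointCfc f y) ≤ multExt φ (∑ i, fieldIntegral μ (F i))) := by
  intro y F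
  have hz := fun i => (haint i).hasFieldIntegral
  have hyI : ∀ i, FieldIntegrable μ fun t => star (a i t) * (x i t : 𝓜(ℂ, A)) * a i t := by
    intro i
    obtain ⟨C, hC⟩ := hxbdd i
    obtain ⟨w, hw⟩ := exists_hasFieldIntegral_conj (hameas i) (hz i)
      (hxmeas i).aestronglyMeasurable_of_coe (hxsa i)
      (fun t => (hC t).trans (le_max_left C 0)) (le_max_right C 0)
    exact hw.fieldIntegrable
  have hy : ∀ i, HasFieldIntegral μ (fun t => star (a i t) * (x i t : 𝓜(ℂ, A)) * a i t) (y i) :=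
    fun i => (hyI i).hasFieldIntegral
  have hysa : ∀ i, IsSelfAdjoint (y i) := fun i => (hy i).isSelfAdjoint fun t => by
    have hxM : IsSelfAdjoint (x i t : 𝓜(ℂ, A)) := isSelfAdjoint_coe (hxsa i t)
    exact hxM.conjugate' (a i t)
  have hycomm : ∀ i j, Commute (y i) (y j) := by
    intro i j
    by_cases hij : i = j
    · subst hij
      exact Commute.refl _
    · exact commute_conj_integral (hScomm i j hij) (haS i) (haS j) (hxS i) (hxS j) (hy i) (hy j)
  have hz0 : ∀ i, 0 ≤ fieldIntegral μ (fun t => star (a i t) * a i t) := fun i =>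
    (hz i).nonneg fun t => star_mul_self_nonneg _
  refine ⟨hyI, hysa, hycomm, fun i hi => ?_, fun i hi => ?_, fun hsp hF φ hφ => ?_⟩
  · exact spectrum_conj_integral_subset (hI i) (hI0 i) (hxsa i) (hxI i) (hz i)
      (haone ▸ Finset.single_le_sum (f := fun i => fieldIntegral μ fun t => star (a i t) * a i t)
        (fun j _ => hz0 j) (Finset.mem_univ i)) (hy i) hi
  · obtain ⟨K, hKI, hK, hxK⟩ := hi
    -- `K` may be empty if `T` is
    have hg : ContinuousOn (fun s => f (Pi.single i s)) (insert 0 K) :=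
      hfcont.comp (continuous_single (A := fun _ => ℝ) i).continuousOn fun s hs =>
        single_mem_univ_pi hI0 i (Set.insert_subset (hI0 i) hKI hs)
    have h1 := fieldIntegrable_conj_cfc (hameas i) (hz i) (hxmeas i).aestronglyMeasurable_of_coe
      (hxsa i) (hK.insert 0) (Set.mem_insert 0 K)
      (fun t => (hxK t).trans (Set.subset_insert 0 K)) hg
    simpa only [F, jointCfc_single_coe hI0 hfcont i (hxsa i _) (hxI i _)] using h1
  · exact extend_jointCfc_le hI0 hfconv hfcont hxsa hxI hz haone hy
      (fun i => (hF i).hasFieldIntegral) hysa hycomm hsp hφ
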